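/- Let $f:\mathbb R^n\to\mathbb R$ be $L_f$-smooth (differentiable with $L_f$-Lipschitz gradient) and $\mu_f$-strongly convex, $0<\mu_f\le L_f$; let $h:\mathbb R^m\to(-\infty,+\infty]$ be proper, closed and convex, $b\in\mathbb R^m$, and let $A\in\mathbb R^{m\times n}$ have operator norm $\|A\|\le L_A$ and all its $m$ singular values $\ge\mu_A$, where $0<\mu_A\le L_A$ (so $A$ has full row rank). Let $x^\star$ be the minimizer of $f(x)+h(Ax-b)$ and $\lambda^\star$ the maximizer of the dual objective $\Phi(\lambda)=-f^\star(-A^{\top}\lambda)-b^{\top}\lambda-h^\star(\lambda)$, where $\varphi^\star(y)=\sup_x\{x^\top y-\varphi(x)\}$ denotes the conjugate function. Put $\kappa_f=L_f/\mu_f$, $\kappa_A=L_A/\mu_A$, $\mu_\Phi=\mu_A^2/L_f$. *AGD.* For $\Psi:\mathbb R^n\to\mathbb R$, parameters $L\ge\mu>0$, a starting point $y_0$ and a tolerance $\delta>0$, $\mathsf{AGD}(\Psi,y_0,\delta)$ puts $y_{-1}=y_0$, $\theta=\frac{\sqrt{L/\mu}-1}{\sqrt{L/\mu}+1}$, iterates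 $$\tilde y_{j+1}=y_j+\theta(y_j-y_{j-1}),\qquad y_{j+1}=\tilde y_{j+1}-\tfrac1L\nabla\Psi(\tilde y_{j+1}),$$ and stops at, and returns, the first $y_j$ with $j\ge1$ and $\|\nabla\Psi(y_j)\|\le\mu\delta$; this $j$ is its number of steps. Each step uses two gradient evaluations, one at $\tilde y_{j+1}$ and one at $y_{j+1}$ for the stopping test. *Inexact proximal point method on the dual.* Given $x_0,\lambda_0$, $\ell\ge\mu_\Phi$ and $D>0$ with $\|x_0-x^\star\|\le D$, let $\rho=\frac{\mu_\Phi}{12\ell}$, $\delta_k=(1-\rho)^{k/2}D$, and for $k=1,2,\dots$ $$x_k=\mathsf{AGD}(\Psi_k,x_{k-1},\delta_k),\qquad \lambda_k=\operatorname{prox}_{h^\star/\ell}\Big(\lambda_{k-1}+\frac{Ax_k-b}{\ell}\Big),$$ where $\operatorname{prox}_{\varphi}(z)=\arg\min_u\{\varphi(u)+\frac12\|z-u\|^2\}$, $\Psi_k(x)=f(x)+g_k^\star(Ax-b)$, $g_k(\lambda)=h^\star(\lambda)+\frac\ell2\|\lambda-\lambda_{k-1}\|^2$, and AGD is run with $L=L_f+L_A^2/\ell$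 and $\mu=\mu_f$. Let $T_k$ be the number of steps of the $k$-th AGD call and $D_\star=\|x_0-x^\star\|+\frac{L_A}{L_f}\|\lambda_0-\lambda^\star\|$. Then: 1. For every $k\ge1$ the $k$-th AGD call terminates, and $$T_k\le 8\sqrt{\frac{L_f+L_A^2/\ell}{\mu_f}}\;\log\Big(10\,\kappa_f\kappa_A\,\frac{\max\{D,D_\star\}}{D}\Big).$$ 2. For every $0<\varepsilon\le D$ there is an integer $T\ge 0$ with $$T\le\frac{48\,\ell}{\mu_\Phi}\log\Big(100\,\kappa_f\kappa_A\,\frac{\max\{D,D_\star\}}{\varepsilon}\Big)$$ such that $\|x_{T'}-x^\star\|\le\varepsilon$ for all $T'\ge T$. 3. If $\ell=\mu_\Phi$ and $D_\star\le D$, then for every $0<\varepsilon\le D$ there is an integer $T\ge0$ such that $\|x_{T'}-x^\star\|\le\varepsilon$ for all $T'\ge T$ and the total number of evaluations of the gradients $\nabla\Psi_k$ in the first $T$ outer iterations is $$\sum_{k=1}^{T}2T_k\le 1100\,\kappa_A\sqrt{\kappa_f}\,\log(10\,\kappa_f\kappa_A)\,\log\Big(100\,\kappa_f\kappa_A\frac{D}{\varepsilon}\Big),$$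 that is, $\tilde O(\kappa_A\sqrt{\kappa_f}\log(D/\varepsilon))$, where $\tilde O$ hides factors logarithmic in $\kappa_f\kappa_A$. -/

import Mathlib

open Set

noncomputable section

/-- `ℝⁿ` with the Euclidean norm and inner product. -/
abbrev Euc (n : ℕ) : Type := EuclideanSpace ℝ (Fin n)

/-! ### Convex analysis -/

/-- `f` is differentiable and its gradient is `L`-Lipschitz. -/
def IsSmooth {n : ℕ} (L : ℝ) (f : Euc n → ℝ) : Prop :=
  Differentiable ℝ f ∧ ∀ x y, ‖gradient f x - gradient f y‖ ≤ L * ‖x - y‖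

/-- An extended-valued function is proper, closed (lower semicontinuous) and convex
(its epigraph is convex). -/
structure ProperClosedConvex {m : ℕ} (h : Euc m → EReal) : Prop where
  ne_bot : ∀ z, h z ≠ ⊥
  exists_ne_top : ∃ z, h z ≠ ⊤
  closed : LowerSemicontinuous h
  convex : Convex ℝ {p : Euc m × ℝ | h p.1 ≤ (p.2 : EReal)}

/-- The conjugate function `φ⋆(y) = sup_x (⟨x, y⟩ - φ(x))`. -/
def conj {m : ℕ} (φ : Euc m → EReal) (y : Euc m) : EReal :=
  ⨆ x, (((inner ℝ x y : ℝ) : EReal) - φ x)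

/-- The proximal operator: `prox φ x` is a minimizer of `u ↦ φ(u) + ½‖x - u‖²`
(the unique one when `φ` is proper, closed and convex). -/
def prox {m : ℕ} (φ : Euc m → EReal) (x : Euc m) : Euc m :=
  Classical.epsilon fun u =>
    IsMinOn (fun v => φ v + ((1 / 2 * ‖x - v‖ ^ 2 : ℝ) : EReal)) univ u

/-! ### Accelerated gradient descent -/

/-- The pair `(y_{j-1}, y_j)` of successive AGD iterates, with `y_{-1} = y_0`,
`ỹ_{j+1} = y_j + θ (y_j - y_{j-1})`, `y_{j+1} = ỹ_{j+1} - ∇Ψ(ỹ_{j+1}) / L`,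
`θ = (√κ - 1) / (√κ + 1)` and `κ = L / μ`. -/
def agdIter {n : ℕ} (Ψ : Euc n → ℝ) (L μ : ℝ) (y₀ : Euc n) : ℕ → Euc n × Euc n
  | 0 => (y₀, y₀)
  | j + 1 =>
    let p := agdIter Ψ L μ y₀ j
    let θ := (√(L / μ) - 1) / (√(L / μ) + 1)
    let yt := p.2 + θ • (p.2 - p.1)
    (p.2, yt - (1 / L) • gradient Ψ yt)

/-- The `repeat … until` loop may exit after the `j`-th pass (`j ≥ 1`):
`‖∇Ψ(y_j)‖ ≤ μ δ`. -/
def AGDStops {n : ℕ} (Ψ : Euc n → ℝ) (L μ : ℝ) (y₀ : Euc n) (δ : ℝ) (j : ℕ) : Prop :=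
  1 ≤ j ∧ ‖gradient Ψ (agdIter Ψ L μ y₀ j).2‖ ≤ μ * δ

/-- The loop exits after finitely many passes. -/
def AGDTerminates {n : ℕ} (Ψ : Euc n → ℝ) (L μ : ℝ) (y₀ : Euc n) (δ : ℝ) : Prop :=
  ∃ j, AGDStops Ψ L μ y₀ δ j

/-- The number of passes through the loop: the first `j` at which it may exit
(meaningful when `AGDTerminates` holds). -/
def agdSteps {n : ℕ} (Ψ : Euc n → ℝ) (L μ : ℝ) (y₀ : Euc n) (δ : ℝ) : ℕ :=
  sInf {j | AGDStops Ψ L μ y₀ δ j}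

/-- The output of `AGD(Ψ, y₀, δ)`. -/
def agd {n : ℕ} (Ψ : Euc n → ℝ) (L μ : ℝ) (y₀ : Euc n) (δ : ℝ) : Euc n :=
  (agdIter Ψ L μ y₀ (agdSteps Ψ L μ y₀ δ)).2

/-! ### The inexact proximal point method on the dual -/

/-- The problem data `f, h, A, b` of `min_x f(x) + h(Ax - b)` together with the inputs of the
algorithm: the parameters `L_f, μ_f, L_A, μ_A, ℓ, D` and the starting points `x₀, λ₀`. No property
is attached here; they are all hypotheses of the theorem. -/
structure Setup (n m : ℕ) where
  f : Euc n → ℝ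
  h : Euc m → EReal
  A : Euc n →L[ℝ] Euc m
  b : Euc m
  Lf : ℝ
  muf : ℝ
  LA : ℝ
  muA : ℝ
  ell : ℝ
  D : ℝ
  x₀ : Euc n
  lam₀ : Euc m

namespace Setup

variable {n m : ℕ} (S : Setup n m)

/-- The primal objective `F(x) = f(x) + h(Ax - b)`. -/
def F (x : Euc n) : EReal := (S.f x : EReal) + S.h (S.A x - S.b)

/-- The dual objective `Φ(λ) = -f⋆(-Aᵀλ) - ⟨b, λ⟩ - h⋆(λ)`. -/
def Phi (lam : Euc m) : EReal :=
  -conj (fun x => (S.f x : EReal)) (-(ContinuousLinearMap.adjoint S.A lam))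
    - ((inner ℝ S.b lam : ℝ) : EReal) - conj S.h lam

def kappaF : ℝ := S.Lf / S.muf

def kappaA : ℝ := S.LA / S.muA

/-- `μ_Φ = μ_A² / L_f`. -/
def muPhi : ℝ := S.muA ^ 2 / S.Lf

/-- `ρ = μ_Φ / (12 ℓ)`. -/
def rho : ℝ := S.muPhi / (12 * S.ell)

/-- `δ_k = (1 - ρ)^{k/2} D`. -/
def delta (k : ℕ) : ℝ := (1 - S.rho) ^ ((k : ℝ) / 2) * S.D

/-- `L_Ψ = L_f + L_A² / ℓ`. -/
def LPsi : ℝ := S.Lf + S.LA ^ 2 / S.ell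

/-- `g(λ) = h⋆(λ) + (ℓ/2) ‖λ - λ'‖²`, where `λ'` is the previous dual iterate. -/
def g (lam' lam : Euc m) : EReal :=
  conj S.h lam + ((S.ell / 2 * ‖lam - lam'‖ ^ 2 : ℝ) : EReal)

/-- `Ψ(x) = f(x) + g⋆(Ax - b)`, where `λ'` is the previous dual iterate; `g⋆` is finite-valued
for `ℓ > 0` and proper closed convex `h`. -/
def Psi (lam' : Euc m) (x : Euc n) : ℝ :=
  S.f x + (conj (S.g lam') (S.A x - S.b)).toReal

/-- The iterates `(x_k, λ_k)`:
`x_k = AGD(Ψ_k, x_{k-1}, δ_k)` and `λ_k = prox_{h⋆/ℓ}(λ_{k-1} + (A x_k - b)/ℓ)`. -/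
def iter : ℕ → Euc n × Euc m
  | 0 => (S.x₀, S.lam₀)
  | k + 1 =>
    let p := iter k
    let x := agd (S.Psi p.2) S.LPsi S.muf p.1 (S.delta (k + 1))
    (x, prox (fun u => ((1 / S.ell : ℝ) : EReal) * conj S.h u)
          (p.2 + (1 / S.ell) • (S.A x - S.b)))

/-- `x_k`. -/
def x (k : ℕ) : Euc n := (S.iter k).1

/-- `λ_k`. -/
def lam (k : ℕ) : Euc m := (S.iter k).2

/-- The `k`-th inner call `AGD(Ψ_k, x_{k-1}, δ_k)` terminates (`k ≥ 1`). -/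
def InnerTerminates (k : ℕ) : Prop :=
  AGDTerminates (S.Psi (S.lam (k - 1))) S.LPsi S.muf (S.x (k - 1)) (S.delta k)

/-- `T_k`: the number of steps of the `k`-th inner call `AGD(Ψ_k, x_{k-1}, δ_k)` (`k ≥ 1`). -/
def innerSteps (k : ℕ) : ℕ :=
  agdSteps (S.Psi (S.lam (k - 1))) S.LPsi S.muf (S.x (k - 1)) (S.delta k)

/-- The number of gradient evaluations in the first `T` outer iterations. Each AGD step evaluates
the gradient twice: at the extrapolated point and, for the exit test, at the new iterate. -/
def gradEvals (T : ℕ) : ℕ := ∑ k ∈ Finset.Icc 1 T, 2 * S.innerSteps k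

/-- `D_⋆ = ‖x₀ - x⋆‖ + (L_A / L_f) ‖λ₀ - λ⋆‖`. -/
def Dstar (xs : Euc n) (ls : Euc m) : ℝ := ‖S.x₀ - xs‖ + S.LA / S.Lf * ‖S.lam₀ - ls‖

end Setup

end

/-! The dual objective is strongly concave with modulus `μ_Φ`: a `1/L_f`-cocoercive gradient of `f`
combines with `‖Aᵀw‖ ≥ μ_A ‖w‖`. Hence an exact proximal step on the dual contracts the distance to
`λ⋆` by `ℓ/(ℓ + μ_Φ)` (`contraction_of_gradPsi_eq_zero`). The exact step is computed on the primal
side: if `x̄` minimizes `Ψ_k`, then `λ̄ = dualStep (A x̄ - b)` satisfies `∇f(x̄) = -Aᵀλ̄`, while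
`Setup.kkt` gives `∇f(x⋆) = -Aᵀλ⋆`. Strong convexity of `f` then bounds `‖x̄ - x⋆‖` by `(L_A/μ_f)
‖λ̄ - λ⋆‖`.

The stopping test and strong convexity of `Ψ_k` give `‖x_k - x̄‖ ≤ δ_k`, and the dual step is
`1/ℓ`-Lipschitz, so inexactness adds at most `L_A δ_k/ℓ` to the dual error. Since `δ_k` decays like
`r^k` with `r = √(1 - ρ)`, more slowly than the exact contraction, the slack absorbs this
perturbation, and both errors decay like `r^k` (`dual_recursion`, `outer_step`).

For the inner cost, `Ψ_k` is smooth and strongly convex (`quadraticBounds_Psi`), and an energy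
argument gives the accelerated rate (`energy_step`, `agdSteps_le`). The warm start `x_{k-1}` lies
within a factor of `δ_k` that is polynomial in the condition numbers and independent of `k`, so each
call costs a bounded number of steps. Multiplying by the number of outer iterations gives the total.
-/

noncomputable section

/-! ### Smooth strongly convex functions through two-sided quadratic models. -/

section QuadraticBounds

variable {E : Type*} [NormedAddCommGroup E] [InnerProductSpace ℝ E]

/-- `f` lies between the quadratic models with slope `G x` and curvatures `μ` and `L`
at every point `x`. -/
structure QuadraticBounds (μ L : ℝ) (f : E → ℝ) (G : E → E) : Prop where
  lower : ∀ x y, f x + inner ℝ (G x) (y - x) + μ / 2 * ‖y - x‖ ^ 2 ≤ f y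
  upper : ∀ x y, f y ≤ f x + inner ℝ (G x) (y - x) + L / 2 * ‖y - x‖ ^ 2

namespace QuadraticBounds

variable {μ L : ℝ} {f : E → ℝ} {G : E → E}

/-- A gradient step decreases the objective. -/
lemma descent (h : QuadraticBounds μ L f G) (hL : 0 < L) (x : E) :
    f (x - (1 / L) • G x) ≤ f x - 1 / (2 * L) * ‖G x‖ ^ 2 := by
  have h1 := h.upper x (x - (1 / L) • G x)
  rw [sub_sub_cancel_left, inner_neg_right, inner_smul_right, norm_neg, norm_smul,
    real_inner_self_eq_norm_sq, Real.norm_of_nonneg (by positivity)] at h1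
  refine h1.trans (le_of_eq ?_)
  field_simp
  ring

lemma norm_sq_le (h : QuadraticBounds μ L f G) (hL : 0 < L) {m : ℝ} (hm : ∀ y, m ≤ f y) (x : E) :
    ‖G x‖ ^ 2 ≤ 2 * L * (f x - m) := by
  have h1 := (hm _).trans (h.descent hL x)
  have h2 : 1 / (2 * L) * ‖G x‖ ^ 2 ≤ f x - m := by linarith
  rw [one_div, inv_mul_le_iff₀ (by positivity)] at h2
  linarith

lemma strongly_monotone (h : QuadraticBounds μ L f G) (x y : E) :
    μ * ‖y - x‖ ^ 2 ≤ inner ℝ (G y - G x) (y - x) := by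
  have h1 := h.lower x y
  have h2 := h.lower y x
  rw [norm_sub_rev x y, ← neg_sub y x, inner_neg_right] at h2
  rw [inner_sub_left]
  linarith

lemma mul_norm_le (h : QuadraticBounds μ L f G) (x y : E) : μ * ‖y - x‖ ≤ ‖G y - G x‖ := by
  rcases (norm_nonneg (y - x)).eq_or_lt with h0 | h0
  · rw [← h0, mul_zero]; positivity
  · have h1 := (h.strongly_monotone x y).trans (real_inner_le_norm _ _)
    refine le_of_mul_le_mul_right ?_ h0
    linarith

/-- Tilting `f` by the linear form `G x` makes `x` a global minimizer, so a gradient step from `y`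
on the tilted function cannot fall below its value at `x`. Adding the resulting inequality to the
one with `x` and `y` exchanged cancels the function values. -/
lemma cocoercive (h : QuadraticBounds μ L f G) (hμ : 0 ≤ μ) (hL : 0 < L) (x y : E) :
    1 / L * ‖G y - G x‖ ^ 2 ≤ inner ℝ (G y - G x) (y - x) := by
  have key : ∀ x y, f x + inner ℝ (G x) (y - x) + 1 / (2 * L) * ‖G y - G x‖ ^ 2 ≤ f y := by
    intro x y
    have hq : QuadraticBounds 0 L (fun z => f z - inner ℝ (G x) z) (fun z => G z - G x) := by
      constructor <;> intro a b
      · have := h.lower a b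
        have : 0 ≤ μ / 2 * ‖b - a‖ ^ 2 := by positivity
        simp only [inner_sub_left, inner_sub_right] at *
        linarith
      · have := h.upper a b
        simp only [inner_sub_left, inner_sub_right] at *
        linarith
    have hm : ∀ z, f x - inner ℝ (G x) x ≤ f z - inner ℝ (G x) z := by
      intro z
      have := hq.lower x z
      simpa using this
    have h1 := (hm _).trans (hq.descent hL y)
    rw [inner_sub_right]
    linarith
  have h1 := key x y
  have h2 := key y x
  rw [norm_sub_rev (G x), ← neg_sub y x, inner_neg_right] at h2
  rw [inner_sub_left]
  have : 1 / L = 1 / (2 * L) + 1 / (2 * L) := by field_simp; norm_num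
  rw [this]
  linarith

end QuadraticBounds

variable [CompleteSpace E]

lemma HasGradientAt.hasDerivAt_line {f : E → ℝ} {g x d : E} {t : ℝ}
    (h : HasGradientAt f g (x + t • d)) :
    HasDerivAt (fun s : ℝ => f (x + s • d)) (inner ℝ g d) t := by
  have h1 : HasDerivAt (fun s : ℝ => x + s • d) d t := by
    simpa using ((hasDerivAt_id t).smul_const d).const_add x
  exact (h.hasFDerivAt.comp_hasDerivAt t h1).congr_deriv (by simp)

/-- First-order optimality condition for the minimization of `φ + q` over a convex set, where `φ` is
convex and `q` is differentiable at the minimizer. -/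
lemma ConvexOn.le_add_inner_of_isMin_add {s : Set E} {φ q : E → ℝ} {u gq : E}
    (hφ : ConvexOn ℝ s φ) (hq : HasGradientAt q gq u) (hu : u ∈ s)
    (hmin : ∀ v ∈ s, φ u + q u ≤ φ v + q v) {v : E} (hv : v ∈ s) :
    φ u ≤ φ v + inner ℝ gq (v - u) := by
  -- Only `q` is differentiated; `φ` is replaced by its chord, an upper bound on the segment by
  -- convexity. The right slope at `0` is therefore nonnegative.
  have h1 : HasDerivAt (fun t : ℝ => t * (φ v - φ u) + q (u + t • (v - u)))
      ((φ v - φ u) + inner ℝ gq (v - u)) 0 := by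
    have h0 : HasGradientAt q gq (u + (0 : ℝ) • (v - u)) := by simpa using hq
    exact (((hasDerivAt_id (0 : ℝ)).mul_const (φ v - φ u)).add h0.hasDerivAt_line).congr_deriv
      (by simp)
  have h2 := h1.tendsto_slope_zero_right
  have h3 : 0 ≤ (φ v - φ u) + inner ℝ gq (v - u) := by
    refine ge_of_tendsto h2 ?_
    filter_upwards [Ioo_mem_nhdsGT (zero_lt_one' ℝ)] with t ht
    have hw : (1 - t) • u + t • v = u + t • (v - u) := by module
    have hc := hφ.2 hu hv (by linarith [ht.2] : 0 ≤ 1 - t) ht.1.le (by ring)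
    have hm := hmin _ (hφ.1 hu hv (by linarith [ht.2] : 0 ≤ 1 - t) ht.1.le (by ring))
    rw [hw] at hc hm
    simp only [smul_eq_mul] at hc
    simp only [zero_add, zero_mul, zero_smul, add_zero, smul_eq_mul]
    have : 0 ≤ t⁻¹ := inv_nonneg.2 ht.1.le
    apply mul_nonneg this
    linarith
  linarith

lemma hasGradientAt_half_mul_norm_sub_sq (c : ℝ) (z u : E) :
    HasGradientAt (fun v => c / 2 * ‖z - v‖ ^ 2) (c • (u - z)) u := by
  rw [hasGradientAt_iff_hasFDerivAt]
  have h := (((hasFDerivAt_id u).const_sub z).norm_sq).const_mul (c / 2)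
  refine h.congr_fderiv ?_
  ext w
  simp
  ring

lemma StrongConvexOn.add_inner_gradient_le {μ : ℝ} {f : E → ℝ}
    (hf : StrongConvexOn univ μ f) (hd : Differentiable ℝ f) (x y : E) :
    f x + inner ℝ (gradient f x) (y - x) + μ / 2 * ‖y - x‖ ^ 2 ≤ f y := by
  have hc := strongConvexOn_iff_convex.1 hf
  -- Taking `q` to be minus the convex function `f - μ/2 ‖·‖²` makes the sum vanish identically, so
  -- every point is a minimizer and the optimality condition becomes the gradient inequality.
  have hg : HasGradientAt (fun v => -(f v - μ / 2 * ‖v‖ ^ 2)) (-(gradient f x - μ • x)) x := by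
    have h1 := (hd x).hasGradientAt.hasFDerivAt
    have h2 := (hasGradientAt_half_mul_norm_sub_sq μ 0 x).hasFDerivAt
    rw [hasGradientAt_iff_hasFDerivAt]
    have h3 := (h1.sub h2).neg
    simp only [zero_sub, norm_neg, sub_zero] at h3
    exact h3.congr_fderiv (by simp)
  have h := hc.le_add_inner_of_isMin_add hg (mem_univ x) (fun v _ => by simp) (mem_univ y)
  simp only [inner_neg_left, inner_sub_left, inner_smul_left, conj_trivial, inner_sub_right] at h ⊢
  rw [@norm_sub_sq_real]
  rw [real_inner_self_eq_norm_sq, real_inner_comm y x] at *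
  nlinarith

/-- Along the segment, the quadratic model minus `f` has nonnegative derivative by Cauchy-Schwarz
and the Lipschitz bound, hence is monotone; this avoids integration. -/
lemma le_add_inner_gradient_of_lipschitz {L : ℝ} {f : E → ℝ} (hd : Differentiable ℝ f)
    (hL : ∀ x y, ‖gradient f x - gradient f y‖ ≤ L * ‖x - y‖) (x y : E) :
    f y ≤ f x + inner ℝ (gradient f x) (y - x) + L / 2 * ‖y - x‖ ^ 2 := by
  set d := y - x with hd'
  let ψ : ℝ → ℝ := fun t => t * inner ℝ (gradient f x) d + L / 2 * ‖d‖ ^ 2 * t ^ 2 - f (x + t • d)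
  have hψ : ∀ t, HasDerivAt ψ
      (inner ℝ (gradient f x) d + L * ‖d‖ ^ 2 * t - inner ℝ (gradient f (x + t • d)) d) t := by
    intro t
    have h1 := (hasDerivAt_id t).mul_const (inner ℝ (gradient f x) d)
    have h2 := ((hasDerivAt_id t).pow 2).const_mul (L / 2 * ‖d‖ ^ 2)
    have h3 := ((hd (x + t • d)).hasGradientAt).hasDerivAt_line
    refine ((h1.add h2).sub h3).congr_deriv ?_
    simp
    ring
  have hmono : MonotoneOn ψ (Icc 0 1) := by
    refine monotoneOn_of_deriv_nonneg (convex_Icc 0 1)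
      (fun t _ => (hψ t).continuousAt.continuousWithinAt)
      (fun t _ => (hψ t).differentiableAt.differentiableWithinAt) ?_
    intro t ht
    rw [interior_Icc] at ht
    rw [(hψ t).deriv]
    have h1 := hL (x + t • d) x
    have h2 := real_inner_le_norm (gradient f (x + t • d) - gradient f x) d
    rw [inner_sub_left] at h2
    rw [add_sub_cancel_left, norm_smul, Real.norm_of_nonneg ht.1.le] at h1
    have h3 := mul_le_mul_of_nonneg_right h1 (norm_nonneg d)
    nlinarith
  have := hmono (left_mem_Icc.2 zero_le_one) (right_mem_Icc.2 zero_le_one) zero_le_one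
  simp only [ψ, zero_mul, zero_smul, add_zero, one_mul, one_smul, one_pow, mul_one, ne_eq,
    OfNat.ofNat_ne_zero, not_false_eq_true, zero_pow, mul_zero] at this
  rw [hd', add_sub_cancel] at this
  linarith

lemma IsSmooth.quadraticBounds {n : ℕ} {L μ : ℝ} {f : Euc n → ℝ} (hf : IsSmooth L f)
    (hfc : StrongConvexOn univ μ f) : QuadraticBounds μ L f (gradient f) :=
  ⟨hfc.add_inner_gradient_le hf.1, le_add_inner_gradient_of_lipschitz hf.1 hf.2⟩

namespace QuadraticBounds

variable {μ L : ℝ} {f : E → ℝ} {G : E → E}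

/-- The first-order remainder is squeezed between `0` and a multiple of `‖y - x‖²`. Thus the
abstract slope `G` is the `gradient` that the algorithm evaluates. -/
lemma hasGradientAt (h : QuadraticBounds μ L f G) (hμ : 0 ≤ μ) (x : E) :
    HasGradientAt f (G x) x := by
  rw [hasGradientAt_iff_isLittleO]
  have h1 : (fun y => f y - f x - inner ℝ (G x) (y - x)) =O[nhds x] fun y => ‖y - x‖ ^ 2 := by
    refine Asymptotics.IsBigO.of_bound (L / 2) (Filter.Eventually.of_forall fun y => ?_)
    have hl := h.lower x y
    have hu := h.upper x y
    have : 0 ≤ μ / 2 * ‖y - x‖ ^ 2 := by positivity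
    rw [Real.norm_of_nonneg (by linarith), Real.norm_of_nonneg (by positivity)]
    linarith
  refine h1.trans_isLittleO ?_
  have h2 : Filter.Tendsto (fun y => ‖y - x‖) (nhds x) (nhds 0) := by
    have : Continuous fun y => ‖y - x‖ := by fun_prop
    simpa using this.tendsto x
  have h3 := (Asymptotics.isLittleO_one_iff ℝ).2 h2
  have h4 := h3.mul_isBigO (Asymptotics.isBigO_refl (fun y => ‖y - x‖) (nhds x))
  simp only [one_mul] at h4
  exact (h4.congr_left fun y => by ring).of_norm_right

lemma gradient_eq (h : QuadraticBounds μ L f G) (hμ : 0 ≤ μ) : gradient f = G :=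
  _root_.gradient_eq (h.hasGradientAt hμ)

lemma exists_min [FiniteDimensional ℝ E] (h : QuadraticBounds μ L f G) (hμ : 0 < μ) :
    ∃ x, ∀ y, f x ≤ f y := by
  have hc : Continuous f :=
    continuous_iff_continuousAt.2 fun x => (h.hasGradientAt hμ.le x).continuousAt
  refine hc.exists_forall_le' 0 ?_
  have : ∀ᶠ y in Filter.cocompact E, 2 / μ * ‖G 0‖ ≤ ‖y‖ :=
    tendsto_norm_cocompact_atTop.eventually_ge_atTop _
  filter_upwards [this] with y hy
  have h1 := h.lower 0 y
  have h2 := neg_le_of_abs_le (abs_real_inner_le_norm (G 0) y)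
  simp only [sub_zero] at h1
  have h3 : ‖G 0‖ ≤ μ / 2 * ‖y‖ := by
    rw [div_mul_eq_mul_div, div_le_iff₀ hμ] at hy
    linarith
  nlinarith [norm_nonneg y]

lemma eq_zero_of_min (h : QuadraticBounds μ L f G) (hμ : 0 ≤ μ) {x : E} (hx : ∀ y, f x ≤ f y) :
    G x = 0 := by
  have h1 : IsLocalMin f x := Filter.Eventually.of_forall hx
  have h2 := h1.hasFDerivAt_eq_zero (h.hasGradientAt hμ x).hasFDerivAt
  simpa using h2

end QuadraticBounds

end QuadraticBounds

/-! ### Convergence of accelerated gradient descent. -/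

section AGD

/-- One step of accelerated gradient descent contracts the energy
`Ψ y - Ψ x⋆ + μ/2 ‖v - x⋆‖²` by the factor `1 - q`, where `q = √(μ/L)`. -/
lemma QuadraticBounds.energy_step {E : Type*} [NormedAddCommGroup E] [InnerProductSpace ℝ E]
    {μ L q : ℝ} {f : E → ℝ} {G : E → E} (h : QuadraticBounds μ L f G) (hμ : 0 < μ) (hL : 0 < L)
    (hq : 0 < q) (hq1 : q ≤ 1) (hqL : q ^ 2 * L = μ) (xs y v yt : E)
    (hyt : (1 + q) • yt = y + q • v) :
    f (yt - (1 / L) • G yt) - f xs + μ / 2 * ‖q • yt + (1 - q) • v - (q / μ) • G yt - xs‖ ^ 2 ≤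
      (1 - q) * (f y - f xs + μ / 2 * ‖v - xs‖ ^ 2) := by
  have hd := h.descent hL yt
  have h1 := h.lower yt xs
  have h2 := h.lower yt y
  set g := G yt
  obtain ⟨a, ha⟩ : ∃ a, a = v - xs := ⟨_, rfl⟩
  obtain ⟨b, hb⟩ : ∃ b, b = yt - xs := ⟨_, rfl⟩
  have e1 : q • yt + (1 - q) • v - (q / μ) • g - xs = q • b + (1 - q) • a - (q / μ) • g := by
    rw [ha, hb]; module
  have e2 : y - yt = q • b - q • a := by
    rw [ha, hb, eq_sub_of_add_eq hyt.symm]; module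
  have e3 : xs - yt = -b := by rw [hb]; abel
  rw [e1, ← ha]
  rw [e2, inner_sub_right, inner_smul_right, inner_smul_right] at h2
  rw [e3, inner_neg_right, norm_neg] at h1
  have e4 : ‖q • b + (1 - q) • a - (q / μ) • g‖ ^ 2 = q ^ 2 * ‖b‖ ^ 2 + (1 - q) ^ 2 * ‖a‖ ^ 2
      + (q / μ) ^ 2 * ‖g‖ ^ 2 + 2 * (q * (1 - q)) * inner ℝ a b
      - 2 * (q ^ 2 / μ) * inner ℝ g b - 2 * (q * (1 - q) / μ) * inner ℝ g a := by
    simp only [← real_inner_self_eq_norm_sq, inner_sub_left, inner_sub_right, inner_add_left,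
      inner_add_right, inner_smul_left, inner_smul_right, conj_trivial]
    rw [real_inner_comm a b, real_inner_comm g a, real_inner_comm g b]
    ring
  have e5 : 0 ≤ ‖a‖ ^ 2 + ‖b‖ ^ 2 - 2 * inner ℝ a b := by
    have := @norm_sub_sq_real _ _ _ a b
    nlinarith [sq_nonneg ‖a - b‖]
  -- Because `q² L = μ`, the coefficient of `‖g‖²` is exactly the gain `1/(2L)` of the descent step.
  -- What remains is the lower model at `xs` weighted by `q`, that at `y` weighted by `1 - q`, and a
  -- multiple of `‖a - b‖²`.
  have e6 : μ / 2 * ‖q • b + (1 - q) • a - (q / μ) • g‖ ^ 2 =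
      μ / 2 * (q ^ 2 * ‖b‖ ^ 2 + (1 - q) ^ 2 * ‖a‖ ^ 2 + 2 * (q * (1 - q)) * inner ℝ a b)
      + 1 / (2 * L) * ‖g‖ ^ 2 - q ^ 2 * inner ℝ g b - q * (1 - q) * inner ℝ g a := by
    rw [e4]
    subst hqL
    field_simp
    ring
  rw [e6]
  have e7 := mul_le_mul_of_nonneg_left h1 hq.le
  have h2' : f yt + (q * inner ℝ g b - q * inner ℝ g a) ≤ f y := by
    have : 0 ≤ μ / 2 * ‖q • b - q • a‖ ^ 2 := by positivity
    linarith
  have e8 := mul_le_mul_of_nonneg_left h2' (sub_nonneg.2 hq1)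
  have e9 : 0 ≤ μ / 2 * (q * (1 - q)) * (‖a‖ ^ 2 + ‖b‖ ^ 2 - 2 * inner ℝ a b) :=
    mul_nonneg (mul_nonneg (by positivity) (mul_nonneg hq.le (sub_nonneg.2 hq1))) e5
  linarith

variable {n : ℕ} {μ L : ℝ} {Ψ : Euc n → ℝ} {G : Euc n → Euc n}

/-- The auxiliary point of the energy is `v_j = y_{j-1} + √(L/μ) (y_j - y_{j-1})`. The momentum `θ`
is precisely what makes the extrapolated point a convex combination of `y_j` and `v_j`; the
convention `y_{-1} = y_0` gives `v_0 = y_0`. -/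
lemma agdIter_energy (h : QuadraticBounds μ L Ψ G) (hμ : 0 < μ) (hμL : μ ≤ L) (y₀ xs : Euc n)
    (j : ℕ) :
    Ψ (agdIter Ψ L μ y₀ j).2 - Ψ xs + μ / 2 * ‖(agdIter Ψ L μ y₀ j).1 +
      √(L / μ) • ((agdIter Ψ L μ y₀ j).2 - (agdIter Ψ L μ y₀ j).1) - xs‖ ^ 2 ≤
    (1 - 1 / √(L / μ)) ^ j * (Ψ y₀ - Ψ xs + μ / 2 * ‖y₀ - xs‖ ^ 2) := by
  have hL : 0 < L := hμ.trans_le hμL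
  have hk1 : 1 ≤ L / μ := (one_le_div hμ).2 hμL
  have hs1 : 1 ≤ √(L / μ) := Real.one_le_sqrt.2 hk1
  have hss : √(L / μ) ^ 2 = L / μ := Real.sq_sqrt (by positivity)
  set s := √(L / μ) with hs
  have hs0 : 0 < s := by linarith
  have hqL : (1 / s) ^ 2 * L = μ := by
    rw [div_pow, hss]; field_simp
  have hq1 : 1 / s ≤ 1 := (div_le_one hs0).2 hs1
  induction j with
  | zero => simp [agdIter]
  | succ j ih =>
    rw [pow_succ' (1 - 1 / s), mul_assoc]
    refine le_trans ?_ (mul_le_mul_of_nonneg_left ih (sub_nonneg.2 hq1))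
    simp only [agdIter, h.gradient_eq hμ.le]
    rw [← hs]
    set p := agdIter Ψ L μ y₀ j
    set yt := p.2 + ((s - 1) / (s + 1)) • (p.2 - p.1) with hyt'
    have hyt : (1 + 1 / s) • yt = p.2 + (1 / s) • (p.1 + s • (p.2 - p.1)) := by
      rw [hyt']
      match_scalars <;> field_simp <;> ring
    clear_value yt
    have := h.energy_step hμ hL (by positivity : 0 < 1 / s) hq1 hqL xs p.2 _ yt hyt
    have e : p.2 + s • (yt - (1 / L) • G yt - p.2) =
        (1 / s) • yt + (1 - 1 / s) • (p.1 + s • (p.2 - p.1)) - (1 / s / μ) • G yt := by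
      have e1 : s * (1 / L) = 1 / s / μ := by
        rw [← hqL]; field_simp
      rw [smul_sub, smul_sub, smul_smul, e1]
      have e2 : s • yt = (1 / s) • yt + (s - 1) • ((1 + 1 / s) • yt) := by
        match_scalars; field_simp; ring
      rw [e2, hyt]
      match_scalars <;> field_simp
      ring
    rw [e]
    exact this

lemma agdIter_norm_gradient_le (h : QuadraticBounds μ L Ψ G) (hμ : 0 < μ) (hμL : μ ≤ L)
    (y₀ : Euc n) {xs : Euc n} (hxs : ∀ y, Ψ xs ≤ Ψ y) (j : ℕ) :
    ‖G (agdIter Ψ L μ y₀ j).2‖ ≤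
      2 * L * Real.exp (-(j / (2 * √(L / μ)))) * ‖y₀ - xs‖ := by
  have hL : 0 < L := hμ.trans_le hμL
  have hs1 : 1 ≤ √(L / μ) := Real.one_le_sqrt.2 ((one_le_div hμ).2 hμL)
  have h0 := agdIter_energy h hμ hμL y₀ xs j
  have h1 := h.norm_sq_le hL hxs (agdIter Ψ L μ y₀ j).2
  have h2 := h.upper xs y₀
  rw [h.eq_zero_of_min hμ.le hxs, inner_zero_left] at h2
  set s := √(L / μ)
  have hs0 : 0 < s := by linarith
  have hexp : (1 - 1 / s) ^ j ≤ Real.exp (-(j / (2 * s))) ^ 2 := by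
    have : Real.exp (-(j / (2 * s))) ^ 2 = Real.exp (-(1 / s)) ^ j := by
      rw [← Real.exp_nat_mul, ← Real.exp_nat_mul]
      congr 1
      push_cast
      field_simp
    rw [this]
    exact pow_le_pow_left₀ (sub_nonneg.2 ((div_le_one hs0).2 hs1))
      (Real.one_sub_le_exp_neg _) j
  have h3 : Ψ y₀ - Ψ xs + μ / 2 * ‖y₀ - xs‖ ^ 2 ≤ L * ‖y₀ - xs‖ ^ 2 := by
    nlinarith [sq_nonneg ‖y₀ - xs‖]
  have h4 : Ψ (agdIter Ψ L μ y₀ j).2 - Ψ xs ≤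
      Real.exp (-(j / (2 * s))) ^ 2 * (L * ‖y₀ - xs‖ ^ 2) := by
    have h5 : 0 ≤ Ψ y₀ - Ψ xs + μ / 2 * ‖y₀ - xs‖ ^ 2 := by
      have := hxs y₀
      have : 0 ≤ μ / 2 * ‖y₀ - xs‖ ^ 2 := by positivity
      linarith
    have h6 := mul_le_mul hexp h3 h5 (by positivity)
    refine le_trans ?_ (h0.trans h6)
    exact le_add_of_nonneg_right (by positivity)
  refine abs_le_of_sq_le_sq' ?_ (by positivity) |>.2
  have h7 := mul_le_mul_of_nonneg_left h4 (by positivity : 0 ≤ 2 * L)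
  have h8 : 0 ≤ 2 * (L * Real.exp (-(j / (2 * s))) * ‖y₀ - xs‖) ^ 2 := by positivity
  linarith

lemma agdSteps_le (h : QuadraticBounds μ L Ψ G) (hμ : 0 < μ) (hμL : μ ≤ L)
    {y₀ xs : Euc n} (hxs : ∀ y, Ψ xs ≤ Ψ y) {R δ : ℝ} (hδ : 0 < δ) (hR : ‖y₀ - xs‖ ≤ R)
    (hδR : δ ≤ R) :
    AGDTerminates Ψ L μ y₀ δ ∧
      (agdSteps Ψ L μ y₀ δ : ℝ) ≤ 2 * √(L / μ) * Real.log (2 * (L / μ) * (R / δ)) + 1 := by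
  have hL : 0 < L := hμ.trans_le hμL
  have hs1 : 1 ≤ √(L / μ) := Real.one_le_sqrt.2 ((one_le_div hμ).2 hμL)
  have hR0 : 0 < R := hδ.trans_le hδR
  have hk1 : 1 ≤ L / μ := (one_le_div hμ).2 hμL
  have hr1 : 1 ≤ R / δ := (one_le_div hδ).2 hδR
  set X := 2 * (L / μ) * (R / δ) with hX
  have hX1 : 1 < X := by nlinarith
  have hlog : 0 < Real.log X := Real.log_pos hX1
  set s := √(L / μ)
  have hs0 : 0 < s := by linarith
  -- With this `j` the exponential is at most `1/X`, and `X` is chosen so that `2 L R / X = μ δ`.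
  -- Since `δ ≤ R` forces `X > 1`, the ceiling is at least `1`, as the loop requires.
  set j := ⌈2 * s * Real.log X⌉₊
  have hj1 : 1 ≤ j := Nat.ceil_pos.2 (by positivity)
  have hexit : AGDStops Ψ L μ y₀ δ j := by
    refine ⟨hj1, ?_⟩
    rw [h.gradient_eq hμ.le]
    refine (agdIter_norm_gradient_le h hμ hμL y₀ hxs j).trans ?_
    have he : Real.exp (-(j / (2 * s))) ≤ X⁻¹ := by
      rw [← Real.exp_log (inv_pos.2 (by linarith : 0 < X)), Real.log_inv]
      refine Real.exp_le_exp.2 (neg_le_neg ?_)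
      rw [le_div_iff₀ (by positivity), mul_comm]
      exact Nat.le_ceil _
    calc 2 * L * Real.exp (-(j / (2 * s))) * ‖y₀ - xs‖ ≤ 2 * L * X⁻¹ * R := by gcongr
      _ = μ * δ := by rw [hX]; field_simp
  refine ⟨⟨j, hexit⟩, ?_⟩
  have h1 : agdSteps Ψ L μ y₀ δ ≤ j := Nat.sInf_le hexit
  have h2 : (j : ℝ) < 2 * s * Real.log X + 1 := Nat.ceil_lt_add_one (by positivity)
  have h3 : (agdSteps Ψ L μ y₀ δ : ℝ) ≤ j := by exact_mod_cast h1
  linarith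

lemma norm_gradient_agd_le {y₀ : Euc n} {δ : ℝ} (h : AGDTerminates Ψ L μ y₀ δ) :
    ‖gradient Ψ (agd Ψ L μ y₀ δ)‖ ≤ μ * δ :=
  (Nat.sInf_mem (s := {j | AGDStops Ψ L μ y₀ δ j}) h).2

end AGD

/-! ### Conjugate functions and their proximal points. -/

section Conjugate

variable {m : ℕ}

/-- The effective domain of an extended-valued function. -/
def effDom (φ : Euc m → EReal) : Set (Euc m) := {v | φ v ≠ ⊤}

/-- Points where `φ` is infinite contribute `⊥` to the supremum, so extended-valued bounds reduce to
real inequalities on the domain. -/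
lemma conj_le_coe_iff {φ : Euc m → EReal} (hbot : ∀ z, φ z ≠ ⊥) {y : Euc m} {c : ℝ} :
    conj φ y ≤ c ↔ ∀ z ∈ effDom φ, inner ℝ z y - (φ z).toReal ≤ c := by
  rw [conj, iSup_le_iff]
  refine forall_congr' fun z => ?_
  by_cases hz : φ z = ⊤
  · simp [hz, effDom]
  · have h1 : φ z = ((φ z).toReal : EReal) := (EReal.coe_toReal hz (hbot z)).symm
    rw [h1, ← EReal.coe_sub, EReal.coe_le_coe_iff]
    simp [effDom, hz]

lemma coe_le_conj {φ : Euc m → EReal} (hbot : ∀ z, φ z ≠ ⊥) {z : Euc m} (hz : z ∈ effDom φ)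
    (y : Euc m) : ((inner ℝ z y - (φ z).toReal : ℝ) : EReal) ≤ conj φ y := by
  refine le_trans (le_of_eq ?_) (le_iSup _ z)
  rw [EReal.coe_sub, EReal.coe_toReal hz (hbot z)]

lemma conj_ne_bot {φ : Euc m → EReal} (hbot : ∀ z, φ z ≠ ⊥) {z : Euc m} (hz : z ∈ effDom φ)
    (y : Euc m) : conj φ y ≠ ⊥ :=
  ne_bot_of_le_ne_bot (EReal.coe_ne_bot _) (coe_le_conj hbot hz y)

lemma inner_sub_le_toReal_conj {φ : Euc m → EReal} (hbot : ∀ z, φ z ≠ ⊥) {z y : Euc m}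
    (hz : z ∈ effDom φ) (hy : y ∈ effDom (conj φ)) :
    inner ℝ z y - (φ z).toReal ≤ (conj φ y).toReal := by
  have h := coe_le_conj hbot hz y
  rwa [← EReal.coe_toReal hy (conj_ne_bot hbot hz y), EReal.coe_le_coe_iff] at h

lemma convexOn_conj {φ : Euc m → EReal} (hbot : ∀ z, φ z ≠ ⊥) (hne : (effDom φ).Nonempty) :
    ConvexOn ℝ (effDom (conj φ)) fun v => (conj φ v).toReal := by
  obtain ⟨z₀, hz₀⟩ := hne
  have key : ∀ u ∈ effDom (conj φ), ∀ v ∈ effDom (conj φ), ∀ a b : ℝ, 0 ≤ a → 0 ≤ b → a + b = 1 →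
      conj φ (a • u + b • v) ≤ ((a * (conj φ u).toReal + b * (conj φ v).toReal : ℝ) : EReal) := by
    intro u hu v hv a b ha hb hab
    rw [conj_le_coe_iff hbot]
    intro z hz
    have h1 := mul_le_mul_of_nonneg_left (inner_sub_le_toReal_conj hbot hz hu) ha
    have h2 := mul_le_mul_of_nonneg_left (inner_sub_le_toReal_conj hbot hz hv) hb
    rw [inner_add_right, inner_smul_right, inner_smul_right]
    have h3 : (φ z).toReal = a * (φ z).toReal + b * (φ z).toReal := by rw [← add_mul, hab, one_mul]
    linarith
  refine ⟨fun u hu v hv a b ha hb hab =>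
    ne_top_of_le_ne_top (EReal.coe_ne_top _) (key u hu v hv a b ha hb hab),
    fun u hu v hv a b ha hb hab => ?_⟩
  have := EReal.toReal_le_toReal (key u hu v hv a b ha hb hab) (conj_ne_bot hbot hz₀ _)
    (EReal.coe_ne_top _)
  rwa [EReal.toReal_coe] at this

lemma lowerSemicontinuous_conj {φ : Euc m → EReal} (hbot : ∀ z, φ z ≠ ⊥) :
    LowerSemicontinuous (conj φ) := by
  unfold conj
  refine lowerSemicontinuous_iSup fun z => ?_
  by_cases hz : φ z = ⊤
  · simp only [hz, EReal.sub_top]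
    exact lowerSemicontinuous_const
  · rw [← EReal.coe_toReal hz (hbot z)]
    simp only [← EReal.coe_sub]
    refine (EReal.continuous_coe_iff.2 ?_).lowerSemicontinuous
    fun_prop

/-- A quadratic regularization of a conjugate function attains its minimum. -/
lemma exists_min_conj_add_sq {φ : Euc m → EReal} (hbot : ∀ z, φ z ≠ ⊥) (hne : (effDom φ).Nonempty)
    (hne' : (effDom (conj φ)).Nonempty) {c : ℝ} (hc : 0 < c) (z : Euc m) :
    ∃ u ∈ effDom (conj φ), ∀ v ∈ effDom (conj φ), (conj φ u).toReal + c / 2 * ‖z - u‖ ^ 2 ≤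
      (conj φ v).toReal + c / 2 * ‖z - v‖ ^ 2 := by
  obtain ⟨w, hw⟩ := hne
  obtain ⟨v₀, hv₀⟩ := hne'
  set φs := fun v => (conj φ v).toReal
  have hcoe : ∀ v ∈ effDom (conj φ), conj φ v = (φs v : EReal) := fun v hv =>
    (EReal.coe_toReal hv (conj_ne_bot hbot hw v)).symm
  set C := φs v₀ + c / 2 * ‖z - v₀‖ ^ 2
  -- a radius outside of which the objective exceeds its value at `v₀`
  set B := |C - (inner ℝ w z - (φ w).toReal)|
  set R := ‖z - v₀‖ + 2 / c * ‖w‖ + B + 2 / c with hR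
  have hcont : LowerSemicontinuous fun v => conj φ v + ((c / 2 * ‖z - v‖ ^ 2 : ℝ) : EReal) := by
    refine (lowerSemicontinuous_conj hbot).add' ?_ fun v =>
      EReal.continuousAt_add (Or.inr (EReal.coe_ne_bot _)) (Or.inr (EReal.coe_ne_top _))
    exact (EReal.continuous_coe_iff.2 (by fun_prop)).lowerSemicontinuous
  have hv₀R : v₀ ∈ Metric.closedBall z R := by
    rw [Metric.mem_closedBall, dist_comm, dist_eq_norm, hR]
    have : 0 ≤ 2 / c * ‖w‖ + B + 2 / c := by positivity
    linarith
  obtain ⟨u, huR, humin⟩ := LowerSemicontinuousOn.exists_isMinOn ⟨v₀, hv₀R⟩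
    (isCompact_closedBall z R) (hcont.lowerSemicontinuousOn _)
  have huv₀ := humin hv₀R
  simp only [mem_ofPred_eq] at huv₀
  rw [hcoe v₀ hv₀, ← EReal.coe_add] at huv₀
  have hu : u ∈ effDom (conj φ) := by
    intro htop
    rw [htop, EReal.top_add_coe] at huv₀
    exact EReal.coe_ne_top _ (top_le_iff.1 huv₀)
  rw [hcoe u hu, ← EReal.coe_add, EReal.coe_le_coe_iff] at huv₀
  refine ⟨u, hu, fun v hv => ?_⟩
  by_cases hvR : v ∈ Metric.closedBall z R
  · have := humin hvR
    simp only [mem_ofPred_eq] at this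
    rwa [hcoe v hv, hcoe u hu, ← EReal.coe_add, ← EReal.coe_add, EReal.coe_le_coe_iff] at this
  · refine huv₀.trans ?_
    rw [Metric.mem_closedBall, dist_comm, dist_eq_norm, not_le] at hvR
    -- The domain point `w` supplies the affine minorant `v ↦ ⟨w, v⟩ - φ w` of the conjugate;
    -- outside the ball the quadratic outgrows its slope `‖w‖` and the gap `B`.
    have h1 := inner_sub_le_toReal_conj hbot hw hv
    have h2 := real_inner_le_norm w (z - v)
    rw [inner_sub_right] at h2
    have h3 : C - (inner ℝ w z - (φ w).toReal) ≤ B := le_abs_self _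
    have hB : 0 ≤ B := abs_nonneg _
    have h4 : ‖w‖ + c / 2 * B + 1 ≤ c / 2 * ‖z - v‖ := by
      have h5 : c / 2 * (2 / c * ‖w‖ + B + 2 / c) ≤ c / 2 * ‖z - v‖ := by
        gcongr
        linarith [norm_nonneg (z - v₀)]
      refine le_trans (le_of_eq ?_) h5
      field_simp
    have h6 : 2 / c + B ≤ ‖z - v‖ := by
      have : 0 ≤ 2 / c * ‖w‖ := by positivity
      linarith [norm_nonneg (z - v₀)]
    have h7 : (1 + c / 2 * B) * ‖z - v‖ + ‖w‖ * ‖z - v‖ ≤ c / 2 * ‖z - v‖ ^ 2 := by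
      have := mul_le_mul_of_nonneg_right h4 (norm_nonneg (z - v))
      linarith
    have h8 : B ≤ (1 + c / 2 * B) * ‖z - v‖ := by
      have : 0 ≤ c / 2 * B * ‖z - v‖ := by positivity
      have : 0 ≤ 2 / c := by positivity
      linarith
    change C ≤ (conj φ v).toReal + _
    linarith

lemma isMinOn_prox_iff {p : Euc m → EReal} (hbot : ∀ v, p v ≠ ⊥) (hne : (effDom p).Nonempty)
    {c : ℝ} (hc : 0 < c) (z u : Euc m) :
    IsMinOn (fun v => ((1 / c : ℝ) : EReal) * p v + ((1 / 2 * ‖z - v‖ ^ 2 : ℝ) : EReal)) univ u ↔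
      u ∈ effDom p ∧ ∀ v ∈ effDom p, (p u).toReal + c / 2 * ‖z - u‖ ^ 2 ≤
        (p v).toReal + c / 2 * ‖z - v‖ ^ 2 := by
  have hc' : 0 < 1 / c := by positivity
  have htop : ∀ v, v ∉ effDom p →
      ((1 / c : ℝ) : EReal) * p v + ((1 / 2 * ‖z - v‖ ^ 2 : ℝ) : EReal) = ⊤ := by
    intro v hv
    rw [not_not.1 hv, EReal.coe_mul_top_of_pos hc', EReal.top_add_coe]
  have hcoe : ∀ v ∈ effDom p, ((1 / c : ℝ) : EReal) * p v + ((1 / 2 * ‖z - v‖ ^ 2 : ℝ) : EReal) =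
      ((1 / c * ((p v).toReal + c / 2 * ‖z - v‖ ^ 2) : ℝ) : EReal) := by
    intro v hv
    conv_lhs => rw [← EReal.coe_toReal hv (hbot v)]
    rw [← EReal.coe_mul, ← EReal.coe_add]
    congr 1
    field_simp
  rw [isMinOn_univ_iff]
  constructor
  · intro h
    obtain ⟨v₀, hv₀⟩ := hne
    have hu : u ∈ effDom p := by
      by_contra hu
      have := h v₀
      rw [htop u hu, hcoe v₀ hv₀] at this
      exact EReal.coe_ne_top _ (top_le_iff.1 this)
    refine ⟨hu, fun v hv => ?_⟩
    have := h v
    rw [hcoe u hu, hcoe v hv, EReal.coe_le_coe_iff] at this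
    exact le_of_mul_le_mul_left this hc'
  · rintro ⟨hu, h⟩ v
    by_cases hv : v ∈ effDom p
    · rw [hcoe u hu, hcoe v hv, EReal.coe_le_coe_iff]
      exact mul_le_mul_of_nonneg_left (h v hv) hc'.le
    · rw [htop v hv]
      exact le_top

/-- The scaled proximal step of a conjugate function: a point `u` of the domain with
`c (z - u)` a subgradient of the conjugate at `u`. -/
lemma prox_conj_spec {φ : Euc m → EReal} (hbot : ∀ z, φ z ≠ ⊥) (hne : (effDom φ).Nonempty)
    (hne' : (effDom (conj φ)).Nonempty) {c : ℝ} (hc : 0 < c) (z : Euc m) {u : Euc m}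
    (hu : u = prox (fun v => ((1 / c : ℝ) : EReal) * conj φ v) z) :
    u ∈ effDom (conj φ) ∧ ∀ v ∈ effDom (conj φ),
      (conj φ u).toReal + inner ℝ (c • (z - u)) (v - u) ≤ (conj φ v).toReal := by
  obtain ⟨w, hw⟩ := hne
  have hbot' := conj_ne_bot hbot hw
  obtain ⟨u₀, hu₀⟩ := exists_min_conj_add_sq hbot ⟨w, hw⟩ hne' hc z
  -- `prox` is an arbitrary choice, so it is known to be a minimizer only after existence has been
  -- shown.
  have h1 := Classical.epsilon_spec (p := fun u => IsMinOn (fun v =>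
    ((1 / c : ℝ) : EReal) * conj φ v + ((1 / 2 * ‖z - v‖ ^ 2 : ℝ) : EReal)) univ u)
    ⟨u₀, (isMinOn_prox_iff hbot' hne' hc z u₀).2 hu₀⟩
  have h2 := (isMinOn_prox_iff hbot' hne' hc z u).1 (hu ▸ h1)
  refine ⟨h2.1, fun v hv => ?_⟩
  have h3 := (convexOn_conj hbot ⟨w, hw⟩).le_add_inner_of_isMin_add
    (hasGradientAt_half_mul_norm_sub_sq c z u) h2.1 h2.2 hv
  rw [← neg_sub z u, smul_neg, inner_neg_left] at h3
  linarith

end Conjugate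

/-! ### Singular values and the adjoint. -/

section Operator

variable {n m : ℕ}

/-- If the first `m` singular values of `A : ℝⁿ → ℝᵐ` are at least `c`, then the adjoint of `A` is
bounded below by `c`. -/
lemma mul_norm_le_norm_adjoint {A : Euc n →L[ℝ] Euc m} {c : ℝ} (hc : 0 < c)
    (hsv : ∀ i < m, c ≤ A.toLinearMap.singularValues i) (w : Euc m) :
    c * ‖w‖ ≤ ‖ContinuousLinearMap.adjoint A w‖ := by
  have hn : Module.finrank ℝ (Euc n) = n := finrank_euclideanSpace_fin
  -- If `n < m`, the singular value with index `n` would be zero, contradicting the lower bound.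
  have hmn : m ≤ n := by
    by_contra! hlt
    have := hsv n hlt
    rw [A.toLinearMap.singularValues_of_finrank_le hn.le] at this
    linarith
  have hT := A.toLinearMap.isSymmetric_adjoint_comp_self
  let σ : Fin m → ℝ := fun i => A.toLinearMap.singularValues i
  let e : Fin m → Euc n := fun i => hT.eigenvectorBasis hn (Fin.castLE hmn i)
  have he : Orthonormal ℝ e :=
    (hT.eigenvectorBasis hn).orthonormal.comp _ (Fin.castLE_injective hmn)
  have hσ : ∀ i, c ≤ σ i := fun i => hsv i i.2
  have hσ0 : ∀ i, 0 < σ i := fun i => hc.trans_le (hσ i)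
  have hAA : ∀ i j, inner ℝ (A (e i)) (A (e j)) = σ i ^ 2 * inner ℝ (e i) (e j) := by
    intro i j
    have h1 : inner ℝ (A.toLinearMap.adjoint (A.toLinearMap (e i))) (e j) =
        inner ℝ (A (e i)) (A (e j)) := A.toLinearMap.adjoint_inner_left _ _
    have h2 : A.toLinearMap.adjoint (A.toLinearMap (e i)) = σ i ^ 2 • e i := by
      have h3 := hT.apply_eigenvectorBasis hn (Fin.castLE hmn i)
      have h4 := A.toLinearMap.sq_singularValues_fin hn (Fin.castLE hmn i)
      rw [← h4] at h3
      exact h3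
    rw [← h1, h2, inner_smul_left]
    simp
  -- These are the left singular vectors; being `m` orthonormal vectors they form a basis of `ℝᵐ`.
  -- Parseval for `u`, Bessel for `e` and `⟨e i, Aᵀw⟩ = σ i ⟨u i, w⟩` give the bound.
  let u : Fin m → Euc m := fun i => (σ i)⁻¹ • A (e i)
  have hu : Orthonormal ℝ u := by
    rw [orthonormal_iff_ite] at he ⊢
    intro i j
    simp only [u, inner_smul_left, inner_smul_right, hAA, he, conj_trivial]
    split_ifs with hij
    · subst hij
      have := (hσ0 i).ne'
      field_simp
    · simp
  let B : OrthonormalBasis (Fin m) ℝ (Euc m) := OrthonormalBasis.mk hu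
    (hu.linearIndependent.span_eq_top_of_card_eq_finrank' (by simp)).ge
  have hB : ∀ i, B i = u i := fun i => by simp [B]
  have h1 : ∑ i, ‖(inner ℝ (B i) w : ℝ)‖ ^ 2 = ‖w‖ ^ 2 := B.sum_sq_norm_inner_right w
  have h2 : ∑ i, ‖(inner ℝ (e i) (ContinuousLinearMap.adjoint A w) : ℝ)‖ ^ 2 ≤
      ‖ContinuousLinearMap.adjoint A w‖ ^ 2 := he.sum_inner_products_le _
  have h3 : ∀ i, c ^ 2 * ‖(inner ℝ (B i) w : ℝ)‖ ^ 2 ≤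
      ‖(inner ℝ (e i) (ContinuousLinearMap.adjoint A w) : ℝ)‖ ^ 2 := by
    intro i
    have h4 : inner ℝ (e i) (ContinuousLinearMap.adjoint A w) = σ i * inner ℝ (B i) w := by
      rw [ContinuousLinearMap.adjoint_inner_right, hB]
      simp only [u, inner_smul_left, conj_trivial]
      rw [mul_inv_cancel_left₀ (hσ0 i).ne']
    rw [h4, norm_mul, mul_pow, Real.norm_of_nonneg (hσ0 i).le]
    have := hσ i
    gcongr
  refine abs_le_of_sq_le_sq' ?_ (norm_nonneg _) |>.2
  rw [mul_pow, ← h1, Finset.mul_sum]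
  exact (Finset.sum_le_sum fun i _ => h3 i).trans h2

lemma surjective_of_mul_norm_le_norm_adjoint {A : Euc n →L[ℝ] Euc m} {c : ℝ} (hc : 0 < c)
    (hA : ∀ w, c * ‖w‖ ≤ ‖ContinuousLinearMap.adjoint A w‖) : Function.Surjective A := by
  have h1 := A.orthogonal_range
  have h2 : (ContinuousLinearMap.adjoint A).ker = ⊥ := by
    rw [Submodule.eq_bot_iff]
    intro w hw
    have h3 := hA w
    rw [show ContinuousLinearMap.adjoint A w = 0 from hw, norm_zero] at h3
    have : ‖w‖ ≤ 0 := nonpos_of_mul_nonpos_right h3 hc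
    simpa using this
  rw [h2, Submodule.orthogonal_eq_bot_iff] at h1
  exact LinearMap.range_eq_top.1 h1

lemma exists_adjoint_eq {A : Euc n →L[ℝ] Euc m} {g : Euc n}
    (hg : ∀ d, A d = 0 → inner ℝ g d = 0) : ∃ w, ContinuousLinearMap.adjoint A w = g := by
  have h1 : g ∈ (A.toLinearMap.ker)ᗮ := by
    rw [Submodule.mem_orthogonal']
    exact fun d hd => hg d hd
  rw [LinearMap.orthogonal_ker] at h1
  exact h1

end Operator

/-! ### Sums and affine compositions of quadratic models. -/

namespace QuadraticBounds

variable {E F : Type*} [NormedAddCommGroup E] [InnerProductSpace ℝ E]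
  {μ₁ μ₂ L₁ L₂ : ℝ} {f₁ f₂ : E → ℝ} {G₁ G₂ : E → E}

lemma add (h₁ : QuadraticBounds μ₁ L₁ f₁ G₁) (h₂ : QuadraticBounds μ₂ L₂ f₂ G₂) :
    QuadraticBounds (μ₁ + μ₂) (L₁ + L₂) (fun x => f₁ x + f₂ x) (fun x => G₁ x + G₂ x) := by
  constructor <;> intro x y <;> rw [inner_add_left]
  · linarith [h₁.lower x y, h₂.lower x y]
  · linarith [h₁.upper x y, h₂.upper x y]

lemma inner_left (c : E) : QuadraticBounds 0 0 (fun x => inner ℝ c x) (fun _ => c) := by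
  constructor <;> intro x y <;> rw [inner_sub_right] <;> linarith

lemma comp_affine [CompleteSpace E] [NormedAddCommGroup F] [InnerProductSpace ℝ F]
    [CompleteSpace F] {L : ℝ} (hL : 0 ≤ L)
    {g : F → ℝ} {G : F → F} (h : QuadraticBounds 0 L g G) (A : E →L[ℝ] F) (b : F) {K : ℝ}
    (hA : ‖A‖ ≤ K) :
    QuadraticBounds 0 (L * K ^ 2) (fun x => g (A x - b))
      (fun x => ContinuousLinearMap.adjoint A (G (A x - b))) := by
  have e : ∀ x y, A y - b - (A x - b) = A (y - x) := fun x y => by rw [map_sub]; abel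
  constructor <;> intro x y
  · have := h.lower (A x - b) (A y - b)
    rw [e] at this
    rw [ContinuousLinearMap.adjoint_inner_left]
    simpa using this
  · have h1 := h.upper (A x - b) (A y - b)
    rw [e] at h1
    rw [ContinuousLinearMap.adjoint_inner_left]
    have h2 : ‖A (y - x)‖ ≤ K * ‖y - x‖ := A.le_of_opNorm_le hA _
    have h3 : ‖A (y - x)‖ ^ 2 ≤ K ^ 2 * ‖y - x‖ ^ 2 := by
      rw [← mul_pow]; gcongr
    have h4 := mul_le_mul_of_nonneg_left h3 (by positivity : 0 ≤ L / 2)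
    linarith

end QuadraticBounds

/-! ### Strong duality and optimality conditions. -/

section Optimality

variable {n m : ℕ}

lemma ProperClosedConvex.convexOn_comp {h : Euc m → EReal} (hh : ProperClosedConvex h)
    (A : Euc n →L[ℝ] Euc m) (b : Euc m) :
    ConvexOn ℝ {x | A x - b ∈ effDom h} fun x => (h (A x - b)).toReal := by
  have key : ∀ x, A x - b ∈ effDom h → ∀ y, A y - b ∈ effDom h → ∀ s t : ℝ, 0 ≤ s → 0 ≤ t →
      s + t = 1 → h (A (s • x + t • y) - b) ≤
        ((s * (h (A x - b)).toReal + t * (h (A y - b)).toReal : ℝ) : EReal) := by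
    intro x hx y hy s t hs ht hst
    have h1 := hh.convex (x := (A x - b, (h (A x - b)).toReal))
      (by simp [EReal.coe_toReal hx (hh.ne_bot _)])
      (y := (A y - b, (h (A y - b)).toReal))
      (by simp [EReal.coe_toReal hy (hh.ne_bot _)]) hs ht hst
    have e : A (s • x + t • y) - b = s • (A x - b) + t • (A y - b) := by
      rw [map_add, map_smul, map_smul]
      nth_rw 1 [← one_smul ℝ b]
      rw [← hst]
      module
    rw [e]
    simpa using h1
  refine ⟨fun x hx y hy s t hs ht hst =>
    ne_top_of_le_ne_top (EReal.coe_ne_top _) (key x hx y hy s t hs ht hst),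
    fun x hx y hy s t hs ht hst => ?_⟩
  have := EReal.toReal_le_toReal (key x hx y hy s t hs ht hst) (hh.ne_bot _) (EReal.coe_ne_top _)
  rwa [EReal.toReal_coe] at this

/-- Karush-Kuhn-Tucker conditions: the primal minimizer `xs` and the dual maximizer `ls` satisfy
`∇f(xs) = -Aᵀ ls` and `A xs - b` is a subgradient of `h⋆` at `ls`. -/
theorem Setup.kkt (S : Setup n m) (hmuf : 0 < S.muf) (hf : IsSmooth S.Lf S.f)
    (hfc : StrongConvexOn univ S.muf S.f) (hh : ProperClosedConvex S.h) (hmuA : 0 < S.muA)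
    (hA : ∀ w, S.muA * ‖w‖ ≤ ‖ContinuousLinearMap.adjoint S.A w‖)
    {xs : Euc n} (hxs : IsMinOn S.F univ xs) {ls : Euc m} (hls : IsMaxOn S.Phi univ ls) :
    gradient S.f xs = -ContinuousLinearMap.adjoint S.A ls ∧ ls ∈ effDom (conj S.h) ∧
      ∀ v ∈ effDom (conj S.h),
        (conj S.h ls).toReal + inner ℝ (S.A xs - S.b) (v - ls) ≤ (conj S.h v).toReal := by
  have hsurj := surjective_of_mul_norm_le_norm_adjoint hmuA hA
  have hF : ∀ x, S.A x - S.b ∈ effDom S.h →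
      S.F x = ((S.f x + (S.h (S.A x - S.b)).toReal : ℝ) : EReal) := by
    intro x hx
    rw [EReal.coe_add, EReal.coe_toReal hx (hh.ne_bot _), Setup.F]
  have hqb := hf.quadraticBounds hfc
  obtain ⟨z₀, hz₀⟩ := hh.exists_ne_top
  rw [isMinOn_univ_iff] at hxs
  rw [isMaxOn_univ_iff] at hls
  set zs := S.A xs - S.b with hzs
  have hzs_dom : zs ∈ effDom S.h := by
    intro htop
    obtain ⟨x₀, hx₀⟩ := hsurj (z₀ + S.b)
    have h1 : S.A x₀ - S.b = z₀ := by rw [hx₀, add_sub_cancel_right]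
    have h2 := hxs x₀
    rw [hF x₀ (by rw [h1]; exact hz₀), Setup.F, ← hzs, htop, EReal.coe_add_top] at h2
    exact EReal.coe_ne_top _ (top_le_iff.1 h2)
  -- optimality of `xs`
  have hopt : ∀ v, S.A v - S.b ∈ effDom S.h →
      (S.h zs).toReal ≤ (S.h (S.A v - S.b)).toReal + inner ℝ (gradient S.f xs) (v - xs) := by
    intro v hv
    refine (hh.convexOn_comp S.A S.b).le_add_inner_of_isMin_add (q := S.f) (u := xs)
      (hf.1 xs).hasGradientAt hzs_dom (fun w hw => ?_) hv
    have h1 := hxs w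
    rw [hF w hw, hF xs hzs_dom, EReal.coe_le_coe_iff] at h1
    linarith
  -- Along `ker A` the term `h` is constant, so optimality forces `∇f(xs)` to be orthogonal to `ker
  -- A`, hence to lie in the range of `Aᵀ`.
  obtain ⟨lh, hlh⟩ : ∃ w, ContinuousLinearMap.adjoint S.A w = -gradient S.f xs := by
    have hle : ∀ d, S.A d = 0 → 0 ≤ inner ℝ (gradient S.f xs) d := by
      intro d hd
      have h1 : S.A (xs + d) - S.b = zs := by rw [map_add, hd, add_zero]
      have h2 := hopt (xs + d) (by rw [h1]; exact hzs_dom)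
      rw [h1, add_sub_cancel_left] at h2
      linarith
    refine exists_adjoint_eq fun d hd => ?_
    have h1 := hle d hd
    have h2 := hle (-d) (by rw [map_neg, hd, neg_zero])
    rw [inner_neg_right] at h2
    rw [inner_neg_left]
    linarith
  -- By surjectivity of `A`, optimality of `xs` tests every point of the domain of `h`; it says that
  -- `lh` is a subgradient of `h` at `zs`, that is, equality in Fenchel-Young.
  have hlh_le : conj S.h lh ≤ ((inner ℝ zs lh - (S.h zs).toReal : ℝ) : EReal) := by
    rw [conj_le_coe_iff hh.ne_bot]
    intro z hz
    obtain ⟨v, hv⟩ := hsurj (z + S.b)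
    have hv' : S.A v - S.b = z := by rw [hv, add_sub_cancel_right]
    have h1 := hopt v (by rw [hv']; exact hz)
    have h2 : inner ℝ (gradient S.f xs) (v - xs) = -(inner ℝ z lh - inner ℝ zs lh) := by
      rw [← neg_neg (gradient S.f xs), ← hlh, inner_neg_left,
        ContinuousLinearMap.adjoint_inner_left, real_inner_comm, ← inner_sub_left, ← hv', hzs,
        map_sub]
      congr 2
      abel
    rw [hv', h2] at h1
    linarith
  have hlh_dom : lh ∈ effDom (conj S.h) := ne_top_of_le_ne_top (EReal.coe_ne_top _) hlh_le
  have hbot := conj_ne_bot hh.ne_bot hz₀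
  have hlh_le' : (conj S.h lh).toReal ≤ inner ℝ zs lh - (S.h zs).toReal := by
    rwa [← EReal.coe_toReal hlh_dom (hbot _), EReal.coe_le_coe_iff] at hlh_le
  have hbf : ∀ x, (fun x => (S.f x : EReal)) x ≠ ⊥ := fun x => EReal.coe_ne_bot _
  have hdf : ∀ x, x ∈ effDom (fun x => (S.f x : EReal)) := fun x => EReal.coe_ne_top _
  -- strong duality
  have hPhi : ((S.f xs + (S.h zs).toReal : ℝ) : EReal) ≤ S.Phi lh := by
    have h1 : conj (fun x => (S.f x : EReal)) (-(ContinuousLinearMap.adjoint S.A lh)) ≤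
        ((inner ℝ xs (gradient S.f xs) - S.f xs : ℝ) : EReal) := by
      rw [conj_le_coe_iff hbf]
      intro x _
      have h2 := hqb.lower xs x
      have : 0 ≤ S.muf / 2 * ‖x - xs‖ ^ 2 := by positivity
      rw [hlh, neg_neg, EReal.toReal_coe, real_inner_comm, real_inner_comm _ xs]
      rw [inner_sub_right] at h2
      linarith
    have h2 : inner ℝ xs (gradient S.f xs) = -inner ℝ (S.A xs) lh := by
      rw [← neg_neg (gradient S.f xs), ← hlh, inner_neg_right,
        ContinuousLinearMap.adjoint_inner_right]
    have h3 := EReal.sub_le_sub (EReal.sub_le_sub (EReal.neg_le_neg_iff.2 h1)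
      (le_refl ((inner ℝ S.b lh : ℝ) : EReal))) hlh_le
    refine le_trans (le_of_eq ?_) h3
    rw [← EReal.coe_neg, ← EReal.coe_sub, ← EReal.coe_sub, h2, hzs, inner_sub_left]
    congr 1
    ring
  have hPls := hPhi.trans (hls lh)
  have hcf : conj (fun x => (S.f x : EReal)) (-(ContinuousLinearMap.adjoint S.A ls)) ≠ ⊤ := by
    intro htop
    rw [Setup.Phi, htop] at hPls
    simp [EReal.bot_sub] at hPls
  have hls_dom : ls ∈ effDom (conj S.h) := by
    intro htop
    rw [Setup.Phi, htop, EReal.sub_top] at hPls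
    exact EReal.coe_ne_bot _ (le_bot_iff.1 hPls)
  -- The dual value at `ls` is at least the primal optimum. Fenchel-Young for `f` and `h` then makes
  -- `xs` a minimizer of the Lagrangian at `ls`; injectivity of `Aᵀ` will identify `ls` with `lh`.
  have hlower : ∀ x, S.f xs + inner ℝ (ContinuousLinearMap.adjoint S.A ls) xs ≤
      S.f x + inner ℝ (ContinuousLinearMap.adjoint S.A ls) x := by
    intro x
    have h1 := inner_sub_le_toReal_conj hbf (hdf x) hcf
    have h2 := inner_sub_le_toReal_conj hh.ne_bot hzs_dom hls_dom
    rw [Setup.Phi, ← EReal.coe_toReal hcf (conj_ne_bot hbf (hdf x) _),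
      ← EReal.coe_toReal hls_dom (hbot _), ← EReal.coe_neg, ← EReal.coe_sub, ← EReal.coe_sub,
      EReal.coe_le_coe_iff] at hPls
    rw [ContinuousLinearMap.adjoint_inner_left, real_inner_comm,
      real_inner_comm x]
    rw [inner_neg_right, EReal.toReal_coe] at h1
    rw [hzs, inner_sub_left] at h2
    linarith
  have hgrad := (hqb.add (QuadraticBounds.inner_left _)).eq_zero_of_min (by linarith) hlower
  have hgrad' : gradient S.f xs = -ContinuousLinearMap.adjoint S.A ls :=
    eq_neg_of_add_eq_zero_left hgrad
  have heq : ls = lh := by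
    have h1 := hA (ls - lh)
    rw [map_sub, hlh, hgrad', neg_neg, sub_self, norm_zero] at h1
    have h2 : ‖ls - lh‖ ≤ 0 := nonpos_of_mul_nonpos_right h1 hmuA
    exact sub_eq_zero.1 (norm_le_zero_iff.1 h2)
  refine ⟨hgrad', hls_dom, fun v hv => ?_⟩
  have h1 := inner_sub_le_toReal_conj hh.ne_bot hzs_dom hv
  rw [heq, inner_sub_right]
  linarith

end Optimality

/-! ### Monotonicity of subgradients. -/

section SubgradientStep

variable {m : ℕ}

/-- `p u + ⟨s, v - u⟩ ≤ p v` on the effective domain of `p`, which contains `u`. -/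
def IsSubgradientAt (p : Euc m → EReal) (s u : Euc m) : Prop :=
  u ∈ effDom p ∧ ∀ v ∈ effDom p, (p u).toReal + inner ℝ s (v - u) ≤ (p v).toReal

lemma IsSubgradientAt.monotone {p : Euc m → EReal} {s s' u u' : Euc m}
    (h : IsSubgradientAt p s u) (h' : IsSubgradientAt p s' u') :
    0 ≤ inner ℝ (s - s') (u - u') := by
  have h1 := h.2 u' h'.1
  have h2 := h'.2 u h.1
  rw [← neg_sub u u', inner_neg_right] at h1
  rw [inner_sub_left]
  linarith

end SubgradientStep

/-! ### The dual proximal step and the inner objective. -/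

namespace Setup

variable {n m : ℕ} (S : Setup n m)

/-- The dual update from `lam'` when `y` is the residual `A x - b`. -/
def dualStep (lam' y : Euc m) : Euc m :=
  prox (fun u => ((1 / S.ell : ℝ) : EReal) * conj S.h u) (lam' + (1 / S.ell) • y)

variable {S}

/-- This is stationarity of the proximal problem scaled by `ℓ`. Paired with monotonicity of
subgradients it yields both the Lipschitz bound and the contraction. -/
lemma dualStep_isSubgradientAt (hh : ProperClosedConvex S.h)
    (hdom : (effDom (conj S.h)).Nonempty) (hell : 0 < S.ell) (lam' y : Euc m) :
    IsSubgradientAt (conj S.h) (y - S.ell • (S.dualStep lam' y - lam')) (S.dualStep lam' y) := by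
  have h := prox_conj_spec hh.ne_bot hh.exists_ne_top hdom hell (lam' + (1 / S.ell) • y)
    (u := S.dualStep lam' y) rfl
  have e : S.ell • (lam' + (1 / S.ell) • y - S.dualStep lam' y) =
      y - S.ell • (S.dualStep lam' y - lam') := by
    match_scalars <;> field_simp
  rw [e] at h
  exact h

/-- The dual update is `1/ℓ`-cocoercive in the residual. -/
lemma dualStep_cocoercive (hh : ProperClosedConvex S.h)
    (hdom : (effDom (conj S.h)).Nonempty) (hell : 0 < S.ell) (lam' y y' : Euc m) :
    S.ell * ‖S.dualStep lam' y - S.dualStep lam' y'‖ ^ 2 ≤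
      inner ℝ (y - y') (S.dualStep lam' y - S.dualStep lam' y') := by
  have h := (dualStep_isSubgradientAt hh hdom hell lam' y).monotone
    (dualStep_isSubgradientAt hh hdom hell lam' y')
  have e : y - S.ell • (S.dualStep lam' y - lam') - (y' - S.ell • (S.dualStep lam' y' - lam')) =
      (y - y') - S.ell • (S.dualStep lam' y - S.dualStep lam' y') := by module
  rw [e, inner_sub_left, inner_smul_left, real_inner_self_eq_norm_sq, conj_trivial] at h
  linarith

lemma dualStep_lipschitz (hh : ProperClosedConvex S.h)
    (hdom : (effDom (conj S.h)).Nonempty) (hell : 0 < S.ell) (lam' y y' : Euc m) :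
    S.ell * ‖S.dualStep lam' y - S.dualStep lam' y'‖ ≤ ‖y - y'‖ := by
  have h := dualStep_cocoercive hh hdom hell lam' y y'
  rcases (norm_nonneg (S.dualStep lam' y - S.dualStep lam' y')).eq_or_lt with h0 | h0
  · rw [← h0, mul_zero]; positivity
  · refine le_of_mul_le_mul_right ?_ h0
    linarith [real_inner_le_norm (y - y') (S.dualStep lam' y - S.dualStep lam' y')]

/-- The conjugate of `g` is finite and attained at the dual update. -/
lemma conj_g (hh : ProperClosedConvex S.h) (hdom : (effDom (conj S.h)).Nonempty)
    (hell : 0 < S.ell) (lam' y : Euc m) :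
    (conj (S.g lam') y).toReal = inner ℝ (S.dualStep lam' y) y -
      ((conj S.h (S.dualStep lam' y)).toReal + S.ell / 2 * ‖S.dualStep lam' y - lam'‖ ^ 2) := by
  obtain ⟨z₀, hz₀⟩ := hh.exists_ne_top
  have hbot := conj_ne_bot hh.ne_bot hz₀
  have hg : ∀ v ∈ effDom (conj S.h), S.g lam' v =
      (((conj S.h v).toReal + S.ell / 2 * ‖v - lam'‖ ^ 2 : ℝ) : EReal) := by
    intro v hv
    rw [g, EReal.coe_add, EReal.coe_toReal hv (hbot v)]
  have hgd : ∀ v, v ∈ effDom (S.g lam') → v ∈ effDom (conj S.h) := by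
    intro v hv htop
    rw [effDom, mem_ofPred_eq, g, htop, EReal.top_add_coe] at hv
    exact hv rfl
  have hgb : ∀ v, S.g lam' v ≠ ⊥ := by
    intro v
    by_cases hv : v ∈ effDom (conj S.h)
    · rw [hg v hv]; exact EReal.coe_ne_bot _
    · rw [g, not_not.1 hv, EReal.top_add_coe]; exact top_ne_bot
  obtain ⟨hu, hsub⟩ := dualStep_isSubgradientAt hh hdom hell lam' y
  set u := S.dualStep lam' y
  have hu' : u ∈ effDom (S.g lam') := by
    rw [effDom, mem_ofPred_eq, hg u hu]; exact EReal.coe_ne_top _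
  have h1 : conj (S.g lam') y = ((inner ℝ u y -
      ((conj S.h u).toReal + S.ell / 2 * ‖u - lam'‖ ^ 2) : ℝ) : EReal) := by
    apply le_antisymm
    · rw [conj_le_coe_iff hgb]
      intro v hv
      have h2 := hsub v (hgd v hv)
      rw [hg v (hgd v hv), EReal.toReal_coe]
      have e : v - lam' = (u - lam') + (v - u) := by abel
      rw [e, norm_add_sq_real]
      rw [inner_sub_left, inner_smul_left, conj_trivial, inner_sub_right y,
        real_inner_comm v y, real_inner_comm u y] at h2
      have h3 : 0 ≤ S.ell / 2 * ‖v - u‖ ^ 2 := by positivity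
      linarith
    · have h2 := coe_le_conj hgb hu' y
      rwa [hg u hu, EReal.toReal_coe] at h2
  rw [h1, EReal.toReal_coe]

/-- Strong convexity of `g` with modulus `ℓ` makes its conjugate `1/ℓ`-smooth, and the maximizer in
the conjugate is its gradient. -/
lemma quadraticBounds_conj_g (hh : ProperClosedConvex S.h) (hdom : (effDom (conj S.h)).Nonempty)
    (hell : 0 < S.ell) (lam' : Euc m) :
    QuadraticBounds 0 (1 / S.ell) (fun y => (conj (S.g lam') y).toReal) (S.dualStep lam') := by
  have key : ∀ y y', (conj (S.g lam') y).toReal + inner ℝ (S.dualStep lam' y) (y' - y) +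
      inner ℝ (y' - y) (S.dualStep lam' y' - S.dualStep lam' y) -
      S.ell / 2 * ‖S.dualStep lam' y' - S.dualStep lam' y‖ ^ 2 ≥
      (conj (S.g lam') y').toReal ∧ (conj (S.g lam') y).toReal +
      inner ℝ (S.dualStep lam' y) (y' - y) ≤ (conj (S.g lam') y').toReal := by
    intro y y'
    rw [conj_g hh hdom hell, conj_g hh hdom hell]
    obtain ⟨hu, hsub⟩ := dualStep_isSubgradientAt hh hdom hell lam' y
    obtain ⟨hu', hsub'⟩ := dualStep_isSubgradientAt hh hdom hell lam' y'
    set u := S.dualStep lam' y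
    set u' := S.dualStep lam' y'
    have h1 := hsub u' hu'
    have h2 := hsub' u hu
    have e1 : ‖u' - lam'‖ ^ 2 = ‖u - lam'‖ ^ 2 + 2 * inner ℝ (u - lam') (u' - u) + ‖u' - u‖ ^ 2 := by
      rw [← norm_add_sq_real]; congr 2; abel
    have e2 : inner ℝ (u' - lam') (u - u') = -inner ℝ (u - lam') (u' - u) - ‖u' - u‖ ^ 2 := by
      rw [← real_inner_self_eq_norm_sq]
      simp only [inner_sub_left, inner_sub_right, real_inner_comm]
      ring
    rw [inner_sub_left, inner_smul_left, conj_trivial] at h1 h2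
    rw [e2] at h2
    rw [e1]
    have h3 : 0 ≤ S.ell * ‖u' - u‖ ^ 2 := by positivity
    simp only [inner_sub_left, inner_sub_right] at *
    simp only [real_inner_comm y u, real_inner_comm y' u,
      real_inner_comm y' u'] at *
    constructor <;> linarith
  constructor <;> intro y y'
  · have := (key y y').2
    linarith
  · have h1 := (key y y').1
    have h2 := real_inner_le_norm (y' - y) (S.dualStep lam' y' - S.dualStep lam' y)
    have h3 : ‖y' - y‖ * ‖S.dualStep lam' y' - S.dualStep lam' y‖ -
        S.ell / 2 * ‖S.dualStep lam' y' - S.dualStep lam' y‖ ^ 2 ≤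
        1 / S.ell / 2 * ‖y' - y‖ ^ 2 := by
      have : 0 ≤ 1 / S.ell / 2 *
          (‖y' - y‖ - S.ell * ‖S.dualStep lam' y' - S.dualStep lam' y‖) ^ 2 := by positivity
      refine le_of_sub_nonneg (this.trans_eq ?_)
      field_simp
      ring
    linarith

variable (S) in
/-- The gradient of `Ψ`. -/
def gradPsi (lam' : Euc m) (x : Euc n) : Euc n :=
  gradient S.f x + ContinuousLinearMap.adjoint S.A (S.dualStep lam' (S.A x - S.b))

lemma quadraticBounds_Psi (hf : IsSmooth S.Lf S.f) (hfc : StrongConvexOn univ S.muf S.f)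
    (hh : ProperClosedConvex S.h) (hdom : (effDom (conj S.h)).Nonempty) (hA : ‖S.A‖ ≤ S.LA)
    (hell : 0 < S.ell) (lam' : Euc m) :
    QuadraticBounds S.muf S.LPsi (S.Psi lam') (S.gradPsi lam') := by
  have h := (hf.quadraticBounds hfc).add ((quadraticBounds_conj_g hh hdom hell lam').comp_affine
    (by positivity) S.A S.b hA)
  rw [add_zero, one_div_mul_eq_div] at h
  exact h

/-- The exact proximal point step on the dual is a contraction. -/
lemma contraction_of_gradPsi_eq_zero (hf : IsSmooth S.Lf S.f)
    (hfc : StrongConvexOn univ S.muf S.f) (hmuf : 0 < S.muf) (hLf : 0 < S.Lf)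
    (hh : ProperClosedConvex S.h) (hell : 0 < S.ell) (hmuA : 0 < S.muA)
    (hAadj : ∀ w, S.muA * ‖w‖ ≤ ‖ContinuousLinearMap.adjoint S.A w‖)
    {xs : Euc n} {ls : Euc m} (hgrad : gradient S.f xs = -ContinuousLinearMap.adjoint S.A ls)
    (hsub : IsSubgradientAt (conj S.h) (S.A xs - S.b) ls) {lam' : Euc m} {xb : Euc n}
    (hxb : S.gradPsi lam' xb = 0) :
    (S.ell + S.muPhi) * ‖S.dualStep lam' (S.A xb - S.b) - ls‖ ≤ S.ell * ‖lam' - ls‖ := by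
  have h1 := (dualStep_isSubgradientAt hh ⟨ls, hsub.1⟩ hell lam' (S.A xb - S.b)).monotone hsub
  have hxb' : gradient S.f xb =
      -ContinuousLinearMap.adjoint S.A (S.dualStep lam' (S.A xb - S.b)) :=
    eq_neg_of_add_eq_zero_left hxb
  set lb := S.dualStep lam' (S.A xb - S.b)
  have h2 := (hf.quadraticBounds hfc).cocoercive hmuf.le hLf xs xb
  have e1 : gradient S.f xb - gradient S.f xs = -ContinuousLinearMap.adjoint S.A (lb - ls) := by
    rw [hxb', hgrad, map_sub]; abel
  rw [e1, norm_neg, inner_neg_left, ContinuousLinearMap.adjoint_inner_left,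
    map_sub S.A xb xs] at h2
  have e2 : S.A xb - S.b - S.ell • (lb - lam') - (S.A xs - S.b) =
      (S.A xb - S.A xs) - S.ell • (lb - lam') := by abel
  rw [e2, inner_sub_left, inner_smul_left, conj_trivial, real_inner_comm] at h1
  -- Here `μ_Φ = μ_A²/L_f` arises: the adjoint bound turns cocoercivity of `∇f` into strong
  -- monotonicity in the dual variable.
  have h3 : S.muPhi * ‖lb - ls‖ ^ 2 ≤ 1 / S.Lf * ‖ContinuousLinearMap.adjoint S.A (lb - ls)‖ ^ 2 := by
    have := pow_le_pow_left₀ (by positivity) (hAadj (lb - ls)) 2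
    rw [mul_pow] at this
    have := mul_le_mul_of_nonneg_left this (by positivity : 0 ≤ 1 / S.Lf)
    refine le_trans (le_of_eq ?_) this
    rw [muPhi]
    ring
  have e3 : lb - lam' = (lb - ls) - (lam' - ls) := by abel
  rw [e3, inner_sub_left (lb - ls), real_inner_self_eq_norm_sq] at h1
  have h4 := real_inner_le_norm (lam' - ls) (lb - ls)
  rcases (norm_nonneg (lb - ls)).eq_or_lt with h0 | h0
  · rw [← h0, mul_zero]; positivity
  · refine le_of_mul_le_mul_right ?_ h0
    have := mul_le_mul_of_nonneg_left h4 hell.le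
    linarith

end Setup

/-! ### Error recursion and complexity of the outer iteration. -/

namespace Setup

variable {n m : ℕ}

/-- The standing assumptions on the problem data in the form in which the convergence analysis uses
them, with the optimality of `xs` and `ls` expressed by the Karush-Kuhn-Tucker conditions. -/
structure Regular (S : Setup n m) (xs : Euc n) (ls : Euc m) : Prop where
  muf_pos : 0 < S.muf
  muf_le_Lf : S.muf ≤ S.Lf
  smooth : IsSmooth S.Lf S.f
  strong : StrongConvexOn univ S.muf S.f
  closed : ProperClosedConvex S.h
  muA_pos : 0 < S.muA
  muA_le_LA : S.muA ≤ S.LA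
  norm_le : ‖S.A‖ ≤ S.LA
  adjoint_ge : ∀ w, S.muA * ‖w‖ ≤ ‖ContinuousLinearMap.adjoint S.A w‖
  muPhi_le_ell : S.muPhi ≤ S.ell
  D_pos : 0 < S.D
  gradient_eq : gradient S.f xs = -ContinuousLinearMap.adjoint S.A ls
  subgradient : IsSubgradientAt (conj S.h) (S.A xs - S.b) ls
  init_le : ‖S.x₀ - xs‖ ≤ S.D

/-- The linear rate `√(1 - ρ)` of the outer iteration. -/
def rate (S : Setup n m) : ℝ := √(1 - S.rho)

/-- The bound for the dual error relative to the `k`-th power of the rate. -/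
def dualRadius (S : Setup n m) (ls : Euc m) : ℝ :=
  ‖S.lam₀ - ls‖ + 12 / 5 * (S.LA * S.Lf / S.muA ^ 2) * S.D

lemma rate_le_exp (S : Setup n m) : S.rate ≤ Real.exp (-(S.rho / 2)) := by
  refine Real.sqrt_le_iff.2 ⟨(Real.exp_pos _).le, ?_⟩
  rw [← Real.exp_nat_mul]
  have : ((2 : ℕ) : ℝ) * -(S.rho / 2) = -S.rho := by push_cast; ring
  rw [this]
  exact Real.one_sub_le_exp_neg _

namespace Regular

variable {S : Setup n m} {xs : Euc n} {ls : Euc m} (H : S.Regular xs ls)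
include H

lemma Lf_pos : 0 < S.Lf := H.muf_pos.trans_le H.muf_le_Lf

lemma LA_pos : 0 < S.LA := H.muA_pos.trans_le H.muA_le_LA

lemma muPhi_pos : 0 < S.muPhi := div_pos (pow_pos H.muA_pos 2) H.Lf_pos

lemma ell_pos : 0 < S.ell := H.muPhi_pos.trans_le H.muPhi_le_ell

lemma one_le_kappaF : 1 ≤ S.kappaF := (one_le_div H.muf_pos).2 H.muf_le_Lf

lemma one_le_kappaA : 1 ≤ S.kappaA := (one_le_div H.muA_pos).2 H.muA_le_LA

lemma rho_pos : 0 < S.rho := div_pos H.muPhi_pos (by linarith [H.ell_pos])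

lemma rho_le : S.rho ≤ 1 / 12 := by
  have := H.ell_pos
  rw [rho, div_le_div_iff₀ (by positivity) (by norm_num)]
  linarith [H.muPhi_le_ell]

lemma rate_ge : 8 / 9 ≤ S.rate :=
  Real.le_sqrt_of_sq_le (by norm_num; linarith [H.rho_le])

lemma one_sub_rho_le_rate : 1 - S.rho ≤ S.rate :=
  Real.le_sqrt_of_sq_le (by nlinarith [H.rho_le, H.rho_pos])

lemma rate_le_one : S.rate ≤ 1 := Real.sqrt_le_one.2 (by linarith [H.rho_pos])

lemma delta_eq (k : ℕ) : S.delta k = S.rate ^ k * S.D := by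
  have h0 : 0 ≤ 1 - S.rho := by linarith [H.rho_le]
  rw [delta, rate, Real.sqrt_eq_rpow, ← Real.rpow_natCast, ← Real.rpow_mul h0]
  congr 2
  ring

lemma muPhi_eq : S.muPhi = 12 * S.rho * S.ell := by
  have := H.ell_pos
  rw [rho]
  field_simp

/-- The exact contraction factor is `1/(1 + 12ρ)`, which is at most `1 - ρ` because `ρ ≤ 1/12`. -/
lemma ell_le_rate_mul : S.ell ≤ S.rate * (S.ell + S.muPhi) := by
  have h1 := mul_le_mul_of_nonneg_right H.one_sub_rho_le_rate
    (add_pos H.ell_pos H.muPhi_pos).le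
  refine le_trans ?_ h1
  rw [H.muPhi_eq]
  have h2 := mul_pos H.rho_pos H.ell_pos
  have h3 := mul_le_mul_of_nonneg_right H.rho_le h2.le
  nlinarith

lemma dualRadius_nonneg : 0 ≤ S.dualRadius ls := by
  have := H.LA_pos
  have := H.Lf_pos
  have := H.D_pos
  unfold dualRadius
  positivity

lemma LPsi_div_le : S.LPsi / S.muf ≤ 2 * S.kappaF * S.kappaA ^ 2 := by
  have h0 := H.muf_pos
  have h1 := H.Lf_pos
  have h2 := H.muA_pos
  have h3 : S.LA ^ 2 / S.ell ≤ S.LA ^ 2 / S.muPhi :=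
    div_le_div_of_nonneg_left (sq_nonneg _) H.muPhi_pos H.muPhi_le_ell
  have h4 : S.LA ^ 2 / S.muPhi = S.Lf * S.kappaA ^ 2 := by
    rw [muPhi, kappaA]; field_simp
  have h5 : S.Lf ≤ S.Lf * S.kappaA ^ 2 :=
    le_mul_of_one_le_right h1.le (one_le_pow₀ H.one_le_kappaA)
  rw [div_le_iff₀ h0]
  calc S.LPsi ≤ 2 * (S.Lf * S.kappaA ^ 2) := by rw [LPsi]; linarith
    _ = _ := by rw [kappaF]; field_simp

lemma muf_le_LPsi : S.muf ≤ S.LPsi := by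
  have := H.ell_pos
  have : 0 ≤ S.LA ^ 2 / S.ell := by positivity
  rw [LPsi]
  linarith [H.muf_le_Lf]

lemma mul_dualRadius_le :
    S.LA / S.muf * S.dualRadius ls ≤
      17 / 5 * (S.kappaF * S.kappaA ^ 2 * max S.D (S.Dstar xs ls)) := by
  have h0 := H.muf_pos
  have h1 := H.Lf_pos
  have h2 := H.muA_pos
  have h3 := H.one_le_kappaF
  have h4 : 1 ≤ S.kappaA ^ 2 := one_le_pow₀ H.one_le_kappaA
  have h5 : S.D ≤ max S.D (S.Dstar xs ls) := le_max_left _ _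
  have h9 := H.LA_pos
  have h6 : S.LA / S.Lf * ‖S.lam₀ - ls‖ ≤ max S.D (S.Dstar xs ls) :=
    le_max_of_le_right (le_add_of_nonneg_left (norm_nonneg _))
  have e : S.LA / S.muf * S.dualRadius ls = S.kappaF * 1 * (S.LA / S.Lf * ‖S.lam₀ - ls‖) +
      12 / 5 * (S.kappaF * S.kappaA ^ 2 * S.D) := by
    rw [dualRadius, kappaF, kappaA]
    field_simp
  rw [e]
  have hM : 0 ≤ max S.D (S.Dstar xs ls) := H.D_pos.le.trans h5
  have h7 : S.kappaF * 1 * (S.LA / S.Lf * ‖S.lam₀ - ls‖) ≤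
      S.kappaF * S.kappaA ^ 2 * max S.D (S.Dstar xs ls) := by gcongr
  have h8 : S.kappaF * S.kappaA ^ 2 * S.D ≤
      S.kappaF * S.kappaA ^ 2 * max S.D (S.Dstar xs ls) := by gcongr
  linarith

lemma D_le : S.D ≤ S.kappaF * S.kappaA ^ 2 * max S.D (S.Dstar xs ls) := by
  have h5 : S.D ≤ max S.D (S.Dstar xs ls) := le_max_left _ _
  have h4 : 1 ≤ S.kappaF * S.kappaA ^ 2 :=
    one_le_mul_of_one_le_of_one_le H.one_le_kappaF (one_le_pow₀ H.one_le_kappaA)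
  exact h5.trans (le_mul_of_one_le_left (H.D_pos.le.trans h5) h4)

/-- The contraction of the exact dual step leaves room for the inexactness of the inner solver. -/
lemma ell_sq_le : S.ell * S.ell ≤ (S.ell + S.muPhi) * S.rate * (S.ell - 5 / 12 * S.muPhi) := by
  have h1 := mul_le_mul_of_nonneg_left H.one_sub_rho_le_rate (add_pos H.ell_pos H.muPhi_pos).le
  have h2 : 0 ≤ S.ell - 5 / 12 * S.muPhi := by linarith [H.muPhi_le_ell, H.ell_pos]
  refine le_trans ?_ (mul_le_mul_of_nonneg_right h1 h2)
  rw [H.muPhi_eq]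
  have hρ := H.rho_le
  have hρ0 := H.rho_pos
  -- This is the expansion of `(1 + 12ρ)(1 - ρ)(1 - 5ρ) - 1`; at `ρ = 1/12` the quadratic factor is
  -- still above `6 - 67/12 > 0`.
  have h3 : 0 ≤ S.ell ^ 2 * (S.rho * (6 - 67 * S.rho + 60 * S.rho ^ 2)) := by
    have := sq_nonneg S.rho
    exact mul_nonneg (sq_nonneg _) (mul_nonneg hρ0.le (by linarith))
  refine le_of_sub_nonneg (h3.trans_eq ?_)
  ring

/-- The second term of `dualRadius` is chosen for this: the error of an inner call uses only the
share `5/12` of `μ_Φ` left free by `ell_sq_le`. -/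
lemma LA_mul_D_le : S.LA * S.D ≤ 5 / 12 * S.dualRadius ls * S.muPhi := by
  have h1 := H.muA_pos
  have h2 := H.Lf_pos
  have h3 : 12 / 5 * (S.LA * S.Lf / S.muA ^ 2) * S.D ≤ S.dualRadius ls :=
    le_add_of_nonneg_left (norm_nonneg _)
  have e : S.LA * S.D = 5 / 12 * (12 / 5 * (S.LA * S.Lf / S.muA ^ 2) * S.D) * S.muPhi := by
    rw [muPhi]; field_simp
  rw [e]
  exact mul_le_mul_of_nonneg_right (by linarith) H.muPhi_pos.le

/-- Here `u` stands for the dual error caused by the inner solver and `v` for the error of the exact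
step. -/
lemma dual_recursion {k : ℕ} {u v : ℝ}
    (hu : S.ell * u ≤ S.LA * (S.rate ^ (k + 1) * S.D))
    (hv : (S.ell + S.muPhi) * v ≤ S.ell * (S.rate ^ k * S.dualRadius ls)) :
    u + v ≤ S.rate ^ (k + 1) * S.dualRadius ls := by
  have hell := H.ell_pos
  have hsum := add_pos hell H.muPhi_pos
  have hr : 0 < S.rate := by linarith [H.rate_ge]
  refine le_of_mul_le_mul_left ?_ (mul_pos hsum hell)
  calc (S.ell + S.muPhi) * S.ell * (u + v)
      = (S.ell + S.muPhi) * (S.ell * u) + S.ell * ((S.ell + S.muPhi) * v) := by ring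
    _ ≤ (S.ell + S.muPhi) * (S.LA * (S.rate ^ (k + 1) * S.D)) +
        S.ell * (S.ell * (S.rate ^ k * S.dualRadius ls)) := by gcongr
    _ = S.rate ^ k * ((S.ell + S.muPhi) * S.rate * (S.LA * S.D) +
        S.ell * S.ell * S.dualRadius ls) := by ring
    _ ≤ S.rate ^ k * ((S.ell + S.muPhi) * S.rate * (5 / 12 * S.dualRadius ls * S.muPhi) +
        (S.ell + S.muPhi) * S.rate * (S.ell - 5 / 12 * S.muPhi) * S.dualRadius ls) := by
      have := H.LA_mul_D_le
      have := H.ell_sq_le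
      have := H.dualRadius_nonneg
      gcongr
    _ = (S.ell + S.muPhi) * S.ell * (S.rate ^ (k + 1) * S.dualRadius ls) := by ring

/-- The bounds for the primal and dual errors, propagated by the outer iteration, together with the
bound for the number of inner steps. -/
lemma outer_step {k : ℕ}
    (hlam : ‖S.lam k - ls‖ ≤ S.rate ^ k * S.dualRadius ls)
    (hx : ‖S.x k - xs‖ ≤ S.rate ^ k * (S.D + S.LA / S.muf * S.dualRadius ls)) :
    (S.InnerTerminates (k + 1) ∧
      (S.innerSteps (k + 1) : ℝ) ≤ 2 * √(S.LPsi / S.muf) * Real.log (2 * (S.LPsi / S.muf) *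
        (9 * (S.kappaF * S.kappaA ^ 2 * (max S.D (S.Dstar xs ls) / S.D)))) + 1) ∧
    ‖S.lam (k + 1) - ls‖ ≤ S.rate ^ (k + 1) * S.dualRadius ls ∧
    ‖S.x (k + 1) - xs‖ ≤ S.rate ^ (k + 1) * (S.D + S.LA / S.muf * S.dualRadius ls) := by
  have hmuf := H.muf_pos
  have hell := H.ell_pos
  have hLA := H.LA_pos
  have hLf := H.Lf_pos
  have hD := H.D_pos
  have hr0 : 0 < S.rate := by linarith [H.rate_ge]
  have hW := H.dualRadius_nonneg
  have hdom : (effDom (conj S.h)).Nonempty := ⟨ls, H.subgradient.1⟩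
  have hΨ := quadraticBounds_Psi H.smooth H.strong H.closed hdom H.norm_le hell (S.lam k)
  obtain ⟨xb, hxb⟩ := hΨ.exists_min hmuf
  have hxb0 := hΨ.eq_zero_of_min hmuf.le hxb
  have hcontr := contraction_of_gradPsi_eq_zero H.smooth H.strong hmuf H.Lf_pos H.closed hell
    H.muA_pos H.adjoint_ge H.gradient_eq H.subgradient hxb0
  have hxb' : gradient S.f xb =
      -ContinuousLinearMap.adjoint S.A (S.dualStep (S.lam k) (S.A xb - S.b)) :=
    eq_neg_of_add_eq_zero_left hxb0
  have hlip := dualStep_lipschitz H.closed hdom hell (S.lam k) (S.A (S.x (k + 1)) - S.b)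
    (S.A xb - S.b)
  have hlam_succ : S.lam (k + 1) = S.dualStep (S.lam k) (S.A (S.x (k + 1)) - S.b) := rfl
  rw [← hlam_succ] at hlip
  set lb := S.dualStep (S.lam k) (S.A xb - S.b)
  -- the exact dual iterate
  have hsum := add_pos hell H.muPhi_pos
  have hlb : ‖lb - ls‖ ≤ S.rate ^ (k + 1) * S.dualRadius ls := by
    refine le_of_mul_le_mul_left ?_ hsum
    calc (S.ell + S.muPhi) * ‖lb - ls‖ ≤ S.ell * ‖S.lam k - ls‖ := hcontr
      _ ≤ S.rate * (S.ell + S.muPhi) * (S.rate ^ k * S.dualRadius ls) :=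
        mul_le_mul H.ell_le_rate_mul hlam (norm_nonneg _) (by positivity)
      _ = _ := by ring
  -- the exact primal iterate
  have hxbs : ‖xb - xs‖ ≤ S.rate ^ (k + 1) * (S.LA / S.muf * S.dualRadius ls) := by
    have h1 := (H.smooth.quadraticBounds H.strong).mul_norm_le xs xb
    rw [hxb', H.gradient_eq, neg_sub_neg, ← map_sub, ← norm_neg (ContinuousLinearMap.adjoint S.A _),
      ← map_neg, neg_sub] at h1
    have h2 : ‖ContinuousLinearMap.adjoint S.A (lb - ls)‖ ≤ S.LA * ‖lb - ls‖ := by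
      refine ContinuousLinearMap.le_of_opNorm_le _ ?_ _
      rw [LinearIsometryEquiv.norm_map]
      exact H.norm_le
    refine le_of_mul_le_mul_left ?_ hmuf
    calc S.muf * ‖xb - xs‖ ≤ S.LA * ‖lb - ls‖ := h1.trans h2
      _ ≤ S.LA * (S.rate ^ (k + 1) * S.dualRadius ls) := by gcongr
      _ = _ := by field_simp
  -- the inner iteration
  set M := max S.D (S.Dstar xs ls)
  have hMD : S.D ≤ M := le_max_left _ _
  set K := S.kappaF * S.kappaA ^ 2
  have hKM : S.D ≤ K * M := H.D_le
  have hWM : S.LA / S.muf * S.dualRadius ls ≤ 17 / 5 * (K * M) := H.mul_dualRadius_le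
  have hδ : 0 < S.delta (k + 1) := by rw [H.delta_eq]; positivity
  have hR : ‖S.x k - xb‖ ≤ S.delta (k + 1) * (9 * (K * (M / S.D))) := by
    have e : S.delta (k + 1) * (9 * (K * (M / S.D))) = S.rate ^ k * (9 * S.rate * (K * M)) := by
      rw [H.delta_eq]; field_simp; ring
    rw [e]
    have h1 : ‖S.x k - xb‖ ≤ ‖S.x k - xs‖ + ‖xb - xs‖ := by
      rw [norm_sub_rev xb xs]; exact norm_sub_le_norm_sub_add_norm_sub _ _ _
    have hrk : 0 < S.rate ^ k := by positivity
    have h2 : S.rate ^ (k + 1) * (S.LA / S.muf * S.dualRadius ls) ≤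
        S.rate ^ k * (S.LA / S.muf * S.dualRadius ls) := by
      refine mul_le_mul_of_nonneg_right ?_ (by positivity)
      rw [pow_succ]
      exact mul_le_of_le_one_right hrk.le H.rate_le_one
    -- The distance to the inner minimizer is at most `1 + 2 · 17/5 < 8` multiples of `K M`; the
    -- factor `9` covers the passage from `r^k` to `r^(k+1)`, as `r ≥ 8/9`.
    have h3 : 8 * (K * M) ≤ 9 * S.rate * (K * M) := by
      refine mul_le_mul_of_nonneg_right ?_ (by linarith)
      linarith [H.rate_ge]
    calc ‖S.x k - xb‖ ≤ S.rate ^ k * (S.D + S.LA / S.muf * S.dualRadius ls) +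
        S.rate ^ k * (S.LA / S.muf * S.dualRadius ls) := by linarith
      _ = S.rate ^ k * (S.D + 2 * (S.LA / S.muf * S.dualRadius ls)) := by ring
      _ ≤ _ := by
        refine mul_le_mul_of_nonneg_left ?_ hrk.le
        linarith
  have hδR : S.delta (k + 1) ≤ S.delta (k + 1) * (9 * (K * (M / S.D))) := by
    refine le_mul_of_one_le_right hδ.le ?_
    have : 1 ≤ K * (M / S.D) := by
      rw [← mul_div_assoc, one_le_div hD]; exact hKM
    linarith
  have hagd := agdSteps_le hΨ hmuf H.muf_le_LPsi hxb hδ hR hδR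
  rw [mul_div_cancel_left₀ _ hδ.ne'] at hagd
  refine ⟨hagd, ?_⟩
  have hgrad : ‖S.gradPsi (S.lam k) (S.x (k + 1))‖ ≤ S.muf * S.delta (k + 1) := by
    rw [← hΨ.gradient_eq hmuf.le]
    exact norm_gradient_agd_le hagd.1
  have hxx : ‖S.x (k + 1) - xb‖ ≤ S.rate ^ (k + 1) * S.D := by
    have h1 := hΨ.mul_norm_le xb (S.x (k + 1))
    rw [hxb0, sub_zero] at h1
    rw [← H.delta_eq]
    exact le_of_mul_le_mul_left (h1.trans hgrad) hmuf
  constructor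
  · have h1 : S.ell * ‖S.lam (k + 1) - lb‖ ≤ S.LA * (S.rate ^ (k + 1) * S.D) := by
      refine hlip.trans ?_
      have : S.A (S.x (k + 1)) - S.b - (S.A xb - S.b) = S.A (S.x (k + 1) - xb) := by
        rw [map_sub]; abel
      rw [this]
      refine (S.A.le_of_opNorm_le H.norm_le _).trans ?_
      gcongr
    have h2 := norm_sub_le_norm_sub_add_norm_sub (S.lam (k + 1)) lb ls
    have h3 : (S.ell + S.muPhi) * ‖lb - ls‖ ≤ S.ell * (S.rate ^ k * S.dualRadius ls) :=
      hcontr.trans (by gcongr)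
    exact h2.trans (H.dual_recursion h1 h3)
  · have := norm_sub_le_norm_sub_add_norm_sub (S.x (k + 1)) xb xs
    linarith

lemma outer_bounds (k : ℕ) :
    ‖S.lam k - ls‖ ≤ S.rate ^ k * S.dualRadius ls ∧
    ‖S.x k - xs‖ ≤ S.rate ^ k * (S.D + S.LA / S.muf * S.dualRadius ls) := by
  induction k with
  | zero =>
    have h1 := H.LA_pos
    have h2 := H.Lf_pos
    have h3 := H.D_pos
    have h4 := H.muf_pos
    have h5 := H.dualRadius_nonneg
    rw [pow_zero, one_mul, one_mul]
    constructor
    · refine le_add_of_nonneg_right (a := ‖S.lam₀ - ls‖) ?_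
      positivity
    · exact H.init_le.trans (le_add_of_nonneg_right (by positivity))
  | succ k ih => exact (H.outer_step ih.1 ih.2).2

lemma norm_x_sub_le (k : ℕ) : ‖S.x k - xs‖ ≤
    S.rate ^ k * (22 / 5 * (S.kappaF * S.kappaA ^ 2 * max S.D (S.Dstar xs ls))) := by
  have : 0 ≤ S.rate := by linarith [H.rate_ge]
  refine (H.outer_bounds k).2.trans (mul_le_mul_of_nonneg_left ?_ (by positivity))
  linarith [H.mul_dualRadius_le, H.D_le]

lemma innerSteps_le {k : ℕ} (hk : 1 ≤ k) :
    S.InnerTerminates k ∧ (S.innerSteps k : ℝ) ≤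
      8 * √((S.Lf + S.LA ^ 2 / S.ell) / S.muf) *
        Real.log (10 * S.kappaF * S.kappaA * (max S.D (S.Dstar xs ls) / S.D)) := by
  obtain ⟨k, rfl⟩ := Nat.exists_eq_add_of_le' hk
  obtain ⟨hT, hle⟩ := (H.outer_step (H.outer_bounds k).1 (H.outer_bounds k).2).1
  refine ⟨hT, hle.trans ?_⟩
  change _ ≤ 8 * √(S.LPsi / S.muf) * _
  have hκ : 1 ≤ S.LPsi / S.muf := (one_le_div H.muf_pos).2 H.muf_le_LPsi
  have hs1 : 1 ≤ √(S.LPsi / S.muf) := Real.one_le_sqrt.2 hκ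
  have ha := H.one_le_kappaF
  have hb := H.one_le_kappaA
  have hc : 1 ≤ max S.D (S.Dstar xs ls) / S.D := (one_le_div H.D_pos).2 (le_max_left _ _)
  have hLψ := H.LPsi_div_le
  set a := S.kappaF
  set b := S.kappaA
  set c := max S.D (S.Dstar xs ls) / S.D
  set Y := 2 * (S.LPsi / S.muf) * (9 * (a * b ^ 2 * c))
  have hY : 0 < Y := by positivity
  -- The fourth power turns the factor `2` into `8`. The extra `2` on the left gives `log 2 ≥ 1/2`,
  -- which pays for the `+ 1` from rounding since the square root is at least `1`.
  have h1 : 2 * Y ≤ (10 * a * b * c) ^ 4 := by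
    calc 2 * Y ≤ 2 * (2 * (2 * a * b ^ 2) * (9 * (a * b ^ 2 * c))) := by
          simp only [Y]; gcongr
      _ = a ^ 2 * b ^ 4 * (72 * c) := by ring
      _ ≤ a ^ 4 * b ^ 4 * (10000 * c ^ 4) := by
          have h2 : a ^ 2 ≤ a ^ 4 := pow_le_pow_right₀ ha (by norm_num)
          have h3 : c ≤ c ^ 4 := le_self_pow₀ hc (by norm_num)
          gcongr
          norm_num
      _ = _ := by ring
  have h2 := Real.log_le_log (by positivity) h1
  rw [Real.log_mul (by norm_num) hY.ne', Real.log_pow] at h2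
  push_cast at h2
  have h3 : (1 / 2 : ℝ) ≤ Real.log 2 := by linarith [Real.log_two_gt_d9]
  have h4 : Real.log Y + 1 / 2 ≤ 4 * Real.log (10 * a * b * c) := by linarith
  have h5 := mul_le_mul_of_nonneg_left h4 (by positivity : 0 ≤ 2 * √(S.LPsi / S.muf))
  linarith

lemma exists_outer_bound {ε : ℝ} (hε : 0 < ε) (hεD : ε ≤ S.D) :
    ∃ T : ℕ, (T : ℝ) ≤ 48 * S.ell / S.muPhi *
        Real.log (100 * S.kappaF * S.kappaA * (max S.D (S.Dstar xs ls) / ε)) ∧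
      ∀ T' : ℕ, T ≤ T' → ‖S.x T' - xs‖ ≤ ε := by
  have ha := H.one_le_kappaF
  have hb := H.one_le_kappaA
  have hc : 1 ≤ max S.D (S.Dstar xs ls) / ε :=
    (one_le_div hε).2 (hεD.trans (le_max_left _ _))
  have hx := H.norm_x_sub_le
  have hr0 : 0 ≤ S.rate := by linarith [H.rate_ge]
  have hρ := H.rho_pos
  have hρ' := H.rho_le
  set M := max S.D (S.Dstar xs ls)
  set a := S.kappaF
  set b := S.kappaA
  obtain ⟨c, hcdef⟩ : ∃ c, c = M / ε := ⟨_, rfl⟩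
  rw [← hcdef] at hc ⊢
  have hM : M = c * ε := by rw [hcdef]; field_simp
  set Y := 22 / 5 * (a * b ^ 2 * c) with hY
  have hY1 : 1 ≤ Y := by
    have : 1 ≤ a * b ^ 2 * c :=
      one_le_mul_of_one_le_of_one_le
        (one_le_mul_of_one_le_of_one_le ha (one_le_pow₀ hb)) hc
    linarith
  have hlogY : 0 ≤ Real.log Y := Real.log_nonneg hY1
  have e48 : 48 * S.ell / S.muPhi = 4 / S.rho := by
    have := H.ell_pos
    rw [H.muPhi_eq]; field_simp; norm_num
  refine ⟨⌈2 / S.rho * Real.log Y⌉₊, ?_, fun T' hT' => ?_⟩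
  · have h1 : (⌈2 / S.rho * Real.log Y⌉₊ : ℝ) < 2 / S.rho * Real.log Y + 1 :=
      Nat.ceil_lt_add_one (by positivity)
    -- The spare factor `2` again pays for the ceiling, now through `1/ρ ≥ 1`.
    have h2 : 2 * Y ≤ (100 * a * b * c) ^ 2 := by
      calc 2 * Y = a * b ^ 2 * (44 / 5 * c) := by rw [hY]; ring
        _ ≤ a ^ 2 * b ^ 2 * (10000 * c ^ 2) := by
          have h2 : a ≤ a ^ 2 := le_self_pow₀ ha (by norm_num)
          have h3 : c ≤ c ^ 2 := le_self_pow₀ hc (by norm_num)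
          gcongr
          norm_num
        _ = _ := by ring
    have h3 := Real.log_le_log (by positivity) h2
    rw [Real.log_mul (by norm_num) (by positivity), Real.log_pow] at h3
    push_cast at h3
    have h4 : (1 / 2 : ℝ) ≤ Real.log 2 := by linarith [Real.log_two_gt_d9]
    have h5 : Real.log Y + 1 / 2 ≤ 2 * Real.log (100 * a * b * c) := by linarith
    have h6 := mul_le_mul_of_nonneg_left h5 (by positivity : 0 ≤ 2 / S.rho)
    have h7 : 1 ≤ 1 / S.rho := (one_le_div hρ).2 (by linarith)
    rw [e48]
    have e1 : 2 / S.rho = 2 * (1 / S.rho) := by ring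
    have e2 : 4 / S.rho = 4 * (1 / S.rho) := by ring
    rw [e1] at h1 h6
    rw [e2, e1]
    linarith
  · have h1 : 2 / S.rho * Real.log Y ≤ T' :=
      (Nat.le_ceil _).trans (by exact_mod_cast hT')
    have h2 : S.rate ^ T' ≤ Y⁻¹ := by
      calc S.rate ^ T' ≤ Real.exp (-(S.rho / 2)) ^ T' := pow_le_pow_left₀ hr0 S.rate_le_exp _
        _ = Real.exp (-(S.rho / 2 * T')) := by rw [← Real.exp_nat_mul]; congr 1; ring
        _ ≤ Real.exp (-Real.log Y) := by
          refine Real.exp_le_exp.2 (neg_le_neg ?_)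
          have := mul_le_mul_of_nonneg_left h1 (by positivity : 0 ≤ S.rho / 2)
          refine le_trans (le_of_eq ?_) this
          field_simp
        _ = Y⁻¹ := by rw [Real.exp_neg, Real.exp_log (by linarith)]
    refine (hx T').trans ?_
    have e : 22 / 5 * (a * b ^ 2 * M) = Y * ε := by rw [hM, hY]; ring
    rw [e]
    calc S.rate ^ T' * (Y * ε) ≤ Y⁻¹ * (Y * ε) := by gcongr
      _ = ε := by field_simp

lemma exists_gradEvals_bound (hell : S.ell = S.muPhi) (hDs : S.Dstar xs ls ≤ S.D) {ε : ℝ}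
    (hε : 0 < ε) (hεD : ε ≤ S.D) :
    ∃ T : ℕ, (S.gradEvals T : ℝ) ≤ 1100 * S.kappaA * √S.kappaF *
        Real.log (10 * S.kappaF * S.kappaA) * Real.log (100 * S.kappaF * S.kappaA * (S.D / ε)) ∧
      ∀ T' : ℕ, T ≤ T' → ‖S.x T' - xs‖ ≤ ε := by
  obtain ⟨T, hT, hT'⟩ := H.exists_outer_bound hε hεD
  refine ⟨T, ?_, hT'⟩
  have hin := fun k (hk : 1 ≤ k) => (H.innerSteps_le hk).2
  have hκ := H.LPsi_div_le
  rw [max_eq_left hDs] at hT hin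
  simp only [div_self H.D_pos.ne', mul_one] at hin
  rw [hell, mul_div_cancel_right₀ _ H.muPhi_pos.ne'] at hT
  have ha := H.one_le_kappaF
  have hb := H.one_le_kappaA
  have hlog : 0 ≤ Real.log (10 * S.kappaF * S.kappaA) := by
    refine Real.log_nonneg ?_
    nlinarith
  -- Since `1.43² > 2`, this follows from the bound on the condition number; the final constant is
  -- `2 · 8 · 1.43 · 48 < 1100`.
  have hsqrt : √((S.Lf + S.LA ^ 2 / S.ell) / S.muf) ≤ 1.43 * (S.kappaA * √S.kappaF) := by
    change √(S.LPsi / S.muf) ≤ _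
    refine Real.sqrt_le_iff.2 ⟨by positivity, hκ.trans ?_⟩
    rw [mul_pow, mul_pow, Real.sq_sqrt (by positivity)]
    have : 0 ≤ S.kappaA ^ 2 * S.kappaF := by positivity
    norm_num
    linarith
  set l₁ := Real.log (10 * S.kappaF * S.kappaA)
  set l₂ := Real.log (100 * S.kappaF * S.kappaA * (S.D / ε))
  have hsum : (S.gradEvals T : ℝ) ≤ T * (2 * (8 * (1.43 * (S.kappaA * √S.kappaF)) * l₁)) := by
    rw [gradEvals]
    push_cast
    have h1 := Finset.sum_le_card_nsmul (Finset.Icc 1 T) (fun k => 2 * (S.innerSteps k : ℝ))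
      (2 * (8 * (1.43 * (S.kappaA * √S.kappaF)) * l₁)) (fun k hk => by
        have h2 := hin k (Finset.mem_Icc.1 hk).1
        have h3 : 8 * √((S.Lf + S.LA ^ 2 / S.ell) / S.muf) * l₁ ≤
          8 * (1.43 * (S.kappaA * √S.kappaF)) * l₁ := by gcongr
        linarith)
    simpa using h1
  have hP : 0 ≤ 2 * (8 * (1.43 * (S.kappaA * √S.kappaF)) * l₁) := by positivity
  have h1 := hsum.trans (mul_le_mul_of_nonneg_right hT hP)
  refine h1.trans ?_
  have hT0 : 0 ≤ l₂ := by
    have : (0 : ℝ) ≤ T := T.cast_nonneg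
    linarith
  have h2 : 0 ≤ S.kappaA * √S.kappaF * l₁ * l₂ := by positivity
  norm_num
  linarith

end Regular

end Setup

end

theorem theorem3p1 {n m : ℕ} (S : Setup n m)
    (hmuf : 0 < S.muf) (hmufLf : S.muf ≤ S.Lf)
    (hf : IsSmooth S.Lf S.f) (hfc : StrongConvexOn Set.univ S.muf S.f)
    (hh : ProperClosedConvex S.h)
    (hmuA : 0 < S.muA) (hmuALA : S.muA ≤ S.LA)
    (hA : ‖S.A‖ ≤ S.LA)
    (hsv : ∀ i < m, S.muA ≤ S.A.toLinearMap.singularValues i)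
    (hell : S.muPhi ≤ S.ell)
    (xs : Euc n) (hxs : IsMinOn S.F Set.univ xs)
    (ls : Euc m) (hls : IsMaxOn S.Phi Set.univ ls)
    (hD : 0 < S.D) (hxD : ‖S.x₀ - xs‖ ≤ S.D) :
    -- every inner call terminates, within the stated number of steps
    (∀ k : ℕ, 1 ≤ k →
      S.InnerTerminates k ∧
      (S.innerSteps k : ℝ) ≤
        8 * √((S.Lf + S.LA ^ 2 / S.ell) / S.muf) *
          Real.log (10 * S.kappaF * S.kappaA * (max S.D (S.Dstar xs ls) / S.D))) ∧
    -- number of outer iterations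
    (∀ ε : ℝ, 0 < ε → ε ≤ S.D →
      ∃ T : ℕ,
        (T : ℝ) ≤ 48 * S.ell / S.muPhi *
          Real.log (100 * S.kappaF * S.kappaA * (max S.D (S.Dstar xs ls) / ε)) ∧
        ∀ T' : ℕ, T ≤ T' → ‖S.x T' - xs‖ ≤ ε) ∧
    -- total number of gradient evaluations for the choice `ℓ = μ_Φ`
    (S.ell = S.muPhi → S.Dstar xs ls ≤ S.D →
      ∀ ε : ℝ, 0 < ε → ε ≤ S.D →
        ∃ T : ℕ,
          (S.gradEvals T : ℝ) ≤ 1100 * S.kappaA * √S.kappaF *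
            Real.log (10 * S.kappaF * S.kappaA) *
            Real.log (100 * S.kappaF * S.kappaA * (S.D / ε)) ∧
          ∀ T' : ℕ, T ≤ T' → ‖S.x T' - xs‖ ≤ ε) := by
  have hadj := mul_norm_le_norm_adjoint hmuA hsv
  obtain ⟨hgrad, hsub⟩ := S.kkt hmuf hf hfc hh hmuA hadj hxs hls
  have H : S.Regular xs ls :=
    ⟨hmuf, hmufLf, hf, hfc, hh, hmuA, hmuALA, hA, hadj, hell, hD, hgrad, hsub, hxD⟩
  exact ⟨fun k hk => H.innerSteps_le hk, fun ε hε hεD => H.exists_outer_bound hε hεD,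
    fun he hDs ε hε hεD => H.exists_gradEvals_bound he hDs hε hεD⟩
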